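/- Let $U\colon\mathbb R^d\to\mathbb R$ be twice differentiable with $L$-Lipschitz gradient and with bounded and Lipschitz continuous Hessian. Let $a_0>0$ be such that $e^{-a_0U}$ is integrable. Suppose $U$ has a nonempty finite set $S$ of global minimizers and none at infinity, i.e. $\liminf_{\|x\|\to\infty}U(x)>U^*:=\min U$. For $a\ge a_0$ let $\mu^a$ be the probability measure on $\mathbb R^d$ with density proportional to $e^{-aU}$. For probability measures let $\mathrm{KL}(\nu\|\mu)$ be the Kullback–Leibler divergence, $W_2$ the Wasserstein-2 distance for the Euclidean norm, and, when $\nu$ and $\mu$ have differentiable positive densities, $\mathrm{FI}(\nu\|\mu)=\int\|\nabla\log(\nu/\mu)\|^2\,d\nu$ the relative Fisher information. Assume: 1. (Log-Sobolev.) For every $a\ge a_0$ there is $\rho_a>0$ with $\mathrm{KL}(\nu\|\mu^a)\le\frac1{2\rho_a}\mathrm{FI}(\nu\|\mu^a)$ for all probability measures $\nu$ with a positive continuously differentiable density. 2. (Regularity.) $\int_{\mathbb R^d}\|x-\hat x\|^2e^{-U(x)}\,dx<\infty$ for some global minimizer $\hat x$; $U$ is six times continuously differentiable on a set whose interior contains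 $S$; and $\nabla^2U(x)$ is positive definite for every $x\in S$. Let $$\mu^*=\sum_{x\in S}\frac{\det(\nabla^2U(x))^{-1/2}}{\sum_{z\in S}\det(\nabla^2U(z))^{-1/2}}\,\delta_x .$$ Then there is a constant $C>0$, depending only on $U$ and $a_0$, such that $$W_2(\mu^a,\mu^*)\le C\,a^{-1/4}\qquad\text{for all }a\ge a_0. \tag{$*$}$$ Moreover, for every $C>0$ satisfying $(*)$ the following holds. Let $\varepsilon\in(0,1/2)$, $\delta\in(0,1)$, $$a\ge\max\Big(a_0,\frac{9C^4L^2}{\varepsilon^2}\Big),\qquad N\in\mathbb N,\quad N\ge\frac{18\ln(1/\delta)}{\varepsilon^2},$$ and let $\tilde\mu$ be a probability measure on $\mathbb R^d$ with $\mathrm{KL}(\tilde\mu\|\mu^a)\le\varepsilon^2/18$. Let $\tilde X^{(1)},\dots,\tilde X^{(N)}$ be i.i.d. samples from $\tilde\mu$ and let $\tilde X=\tilde X^{(I)}$ with $I\in\operatorname{arg\,min}_{1\le i\le N}U(\tilde X^{(i)})$ (ties broken arbitrarily). Then $$\mathbb P\big(U(\tilde X)-U^*\ge\varepsilon\big)\le\delta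 .$$ -/

import Mathlib

open MeasureTheory ProbabilityTheory InformationTheory
open scoped ENNReal NNReal Gradient

noncomputable section

namespace GibbsOpt

/-- The Euclidean space `ℝ^d`. -/
abbrev E (d : ℕ) : Type := EuclideanSpace ℝ (Fin d)

/-! ### The potential and its minimizers -/

/-- The set of global minimizers of `U`. -/
def globalMinimizers {d : ℕ} (U : E d → ℝ) : Set (E d) :=
  {x | ∀ y, U x ≤ U y}

/-- The minimal value `U*` of `U` (attained as soon as `U` has a global minimizer). -/
def minValue {d : ℕ} (U : E d → ℝ) : ℝ := ⨅ x, U x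

/-- The Hessian matrix of `U` at `x`, that is, the matrix of second partial derivatives. -/
def hessianMatrix {d : ℕ} (U : E d → ℝ) (x : E d) : Matrix (Fin d) (Fin d) ℝ :=
  Matrix.of fun i j =>
    fderiv ℝ (fderiv ℝ U) x (EuclideanSpace.single i 1) (EuclideanSpace.single j 1)

/-- The standing assumptions on the potential `U`, with smoothness constant `L` and
integrability parameter `a₀`. -/
structure IsPotential {d : ℕ} (U : E d → ℝ) (L : ℝ≥0) (a₀ : ℝ) : Prop where
  /-- `U` is differentiable -/
  differentiable : Differentiable ℝ U
  /-- and its derivative is differentiable. -/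
  twice_differentiable : Differentiable ℝ (fderiv ℝ U)
  /-- `L`-smoothness: the gradient is `L`-Lipschitz. -/
  smooth : LipschitzWith L (gradient U)
  /-- The Hessian is Lipschitz continuous -/
  hessian_lipschitz : ∃ M : ℝ≥0, LipschitzWith M (fderiv ℝ (fderiv ℝ U))
  /-- and bounded. -/
  hessian_bounded : ∃ B : ℝ, ∀ x, ‖fderiv ℝ (fderiv ℝ U) x‖ ≤ B
  a₀_pos : 0 < a₀
  integrable_exp : Integrable (fun x => Real.exp (-(a₀ * U x)))
  finite_minimizers : (globalMinimizers U).Finite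
  nonempty_minimizers : (globalMinimizers U).Nonempty
  /-- No global minimizer at infinity: `liminf_{‖x‖ → ∞} U(x) > U*`. -/
  no_minimizer_at_infinity :
    ∃ c : ℝ, minValue U < c ∧ ∀ᶠ x in Filter.cocompact (E d), c ≤ U x

/-- The regularity assumptions on `U` near its global minimizers, with a moment condition. -/
structure IsRegularAtMinimizers {d : ℕ} (U : E d → ℝ) : Prop where
  moment : ∃ xhat ∈ globalMinimizers U,
    Integrable (fun x => ‖x - xhat‖ ^ 2 * Real.exp (-(U x)))
  contDiffOn : ∃ F : Set (E d), globalMinimizers U ⊆ interior F ∧ ContDiffOn ℝ 6 U F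
  hessian_posDef : ∀ x ∈ globalMinimizers U, (hessianMatrix U x).PosDef

/-! ### Gibbs measures and the limiting mixture of Dirac measures -/

/-- The measure with density `p` with respect to Lebesgue measure. -/
def densityMeasure {d : ℕ} (p : E d → ℝ) : Measure (E d) :=
  (volume : Measure (E d)).withDensity fun x => ENNReal.ofReal (p x)

/-- The density of the Gibbs measure `μ^a`, proportional to `exp (-a U)`. -/
def gibbsDensity {d : ℕ} (U : E d → ℝ) (a : ℝ) (x : E d) : ℝ :=
  Real.exp (-(a * U x)) / ∫ y, Real.exp (-(a * U y))

/-- The Gibbs measure `μ^a`. -/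
def gibbs {d : ℕ} (U : E d → ℝ) (a : ℝ) : Measure (E d) :=
  densityMeasure (gibbsDensity U a)

/-- The unnormalized Laplace weight `det (∇²U(x))^(-1/2)` of a global minimizer `x`. -/
def laplaceWeight {d : ℕ} (U : E d → ℝ) (x : E d) : ℝ :=
  (Real.sqrt (hessianMatrix U x).det)⁻¹

/-- The measure `μ*`: the mixture of the Dirac measures at the global minimizers, with weights
`det (∇²U(x))^(-1/2) / ∑_z det (∇²U(z))^(-1/2)`. -/
def limitMeasure {d : ℕ} (U : E d → ℝ) : Measure (E d) :=
  Measure.sum fun x : globalMinimizers U =>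
    ENNReal.ofReal (laplaceWeight U x / ∑ᶠ z ∈ globalMinimizers U, laplaceWeight U z) •
      Measure.dirac (x : E d)

/-! ### Fisher information, log-Sobolev inequality, Wasserstein distance -/

/-- The relative Fisher information `∫ ‖∇ log (p/q)‖² p dx` of the density `p` with respect to
the density `q`, with values in `[0, ∞]` (used for differentiable positive densities). -/
def fisherInfo {d : ℕ} (p q : E d → ℝ) : ℝ≥0∞ :=
  ∫⁻ x, ENNReal.ofReal (‖gradient (fun z => Real.log (p z / q z)) x‖ ^ 2)
    ∂(densityMeasure p)

/-- The measure with density `q` satisfies a log-Sobolev inequality with coefficient `ρ`: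
`KL(ν‖μ) ≤ (1 / (2ρ)) FI(ν‖μ)` for every probability measure `ν` with a density that is
positive (full support) and continuously differentiable (so that the Fisher information is
given by the classical gradient). -/
def LogSobolev {d : ℕ} (q : E d → ℝ) (ρ : ℝ) : Prop :=
  ∀ p : E d → ℝ, ContDiff ℝ 1 p → (∀ x, 0 < p x) → IsProbabilityMeasure (densityMeasure p) →
    klDiv (densityMeasure p) (densityMeasure q) ≤ ENNReal.ofReal (1 / (2 * ρ)) * fisherInfo p q

/-- All Gibbs measures `μ^a`, `a ≥ a₀`, satisfy a log-Sobolev inequality, with a coefficient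
`ρ_a > 0` that may depend on `a`. -/
def GibbsLogSobolev {d : ℕ} (U : E d → ℝ) (a₀ : ℝ) : Prop :=
  ∀ a : ℝ, a₀ ≤ a → ∃ ρ : ℝ, 0 < ρ ∧ LogSobolev (gibbsDensity U a) ρ

/-- The set of couplings of `μ` and `ν`. -/
def couplings {d : ℕ} (μ ν : Measure (E d)) : Set (Measure (E d × E d)) :=
  {ζ | ζ.map Prod.fst = μ ∧ ζ.map Prod.snd = ν}

/-- The Wasserstein-2 distance, with values in `[0, ∞]`. -/
def W2 {d : ℕ} (μ ν : Measure (E d)) : ℝ≥0∞ :=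
  (⨅ ζ ∈ couplings μ ν, ∫⁻ z, ENNReal.ofReal (‖z.1 - z.2‖ ^ 2) ∂ζ) ^ (1 / 2 : ℝ)

/-- `W₂(μ^a, μ*) ≤ C a^(-1/4)` for all `a ≥ a₀`. -/
def WassersteinRate {d : ℕ} (U : E d → ℝ) (a₀ C : ℝ) : Prop :=
  ∀ a : ℝ, a₀ ≤ a → W2 (gibbs U a) (limitMeasure U) ≤ ENNReal.ofReal (C * a ^ (-(1 / 4) : ℝ))

/-! ### The algorithm -/

/-- The random point `Xout` is an output of the global optimization algorithm run with `N` samples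
of an oracle with law `μt`: it is a sample `X (I ω)` of least objective value
among `N` independent samples `X i` of law `μt` (ties are broken in any way). -/
def IsAlgorithmOutput {d : ℕ} {Ω : Type*} [MeasurableSpace Ω] (P : Measure Ω) (U : E d → ℝ)
    (μt : Measure (E d)) (N : ℕ) (Xout : Ω → E d) : Prop :=
  ∃ (X : Fin N → Ω → E d) (I : Ω → Fin N),
    (∀ i, Measurable (X i)) ∧ (∀ i, P.map (X i) = μt) ∧ iIndepFun X P ∧
    (∀ ω j, U (X (I ω) ω) ≤ U (X j ω)) ∧ ∀ ω, Xout ω = X (I ω) ω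

end GibbsOpt

end

namespace GibbsOpt

variable {d : ℕ} {U : E d → ℝ} {L : ℝ≥0} {a₀ a : ℝ}

/-! ### Quadratic growth and the Gibbs density -/

/-! Guarantee. The limit measure lives on the minimizers, and `U x - U* ≤ L ‖x - y‖²` for every
minimizer `y`. A nearly optimal coupling thus turns the Wasserstein rate into a bound `ε / 2` on the
Gibbs mean of `U - U*`, and Markov's inequality gives the bad event Gibbs mass at most `1 / 2`
(`gibbs_le_half`). An entropy inequality (`measure_le_klDiv_add`) transfers this to `μt` with the
bound `9 / 10`, and independence raises it to the power `N`.

Rate. Put `a = t²` and rescale space by `t` around each minimizer. The quadratic Taylor model gives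
the scaled mass of a small ball up to `O(1 / t)` (`laplace_ball`), while the scaled second moment in
the ball is `O(1 / t²)` (`second_moment_ball`) and everything away from the minimizers is `O(1 / t)`
(`moment_outside`). So the ball masses miss the limiting weights by `O(1 / t)`. Moving that excess
over a bounded distance costs `O(1 / t)` in `W2 ^ 2` (`W2_sq_le_atomic`), which yields `a ^ (-1 /
4)`.

Mass far out travels arbitrarily far, so a second moment under the weight `exp (-a₀ U)` is needed.
It is extracted from the log-Sobolev inequality by testing it on bounded tilts of the Gibbs density
(`integral_tilt_le`). -/

lemma minValue_eq {x : E d} (hx : x ∈ globalMinimizers U) : minValue U = U x :=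
  le_antisymm (ciInf_le ⟨U x, by rintro _ ⟨y, rfl⟩; exact hx y⟩ x) (le_ciInf hx)

lemma IsPotential.minValue_le (hU : IsPotential U L a₀) (x : E d) : minValue U ≤ U x := by
  obtain ⟨y, hy⟩ := hU.nonempty_minimizers
  exact minValue_eq hy ▸ hy x

lemma fderiv_eq_zero_of_mem {x : E d} (hx : x ∈ globalMinimizers U) : fderiv ℝ U x = 0 :=
  IsLocalMin.fderiv_eq_zero (Filter.Eventually.of_forall hx)

lemma norm_fderiv_sub_le (hU : IsPotential U L a₀) (x y : E d) :
    ‖fderiv ℝ U x - fderiv ℝ U y‖ ≤ L * ‖x - y‖ := by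
  have h := hU.smooth.dist_le_mul x y
  simp only [gradient] at h
  rwa [LinearIsometryEquiv.dist_map, dist_eq_norm, dist_eq_norm] at h

/-- Mean value inequality on the ball about `y` through `x`: the derivative vanishes at `y`, so it
is at most `L ‖x - y‖` there. The sharp factor `1 / 2` is not needed. -/
lemma sub_minValue_le (hU : IsPotential U L a₀) {y : E d} (hy : y ∈ globalMinimizers U)
    (x : E d) : U x - minValue U ≤ L * ‖x - y‖ ^ 2 := by
  have h := (convex_closedBall y ‖x - y‖).norm_image_sub_le_of_norm_fderiv_le
    (𝕜 := ℝ) (f := U) (C := L * ‖x - y‖) (fun z _ => hU.differentiable z)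
    (fun z hz => by
      have h1 := norm_fderiv_sub_le hU z y
      rw [fderiv_eq_zero_of_mem hy, sub_zero] at h1
      refine h1.trans (mul_le_mul_of_nonneg_left ?_ L.2)
      simpa [dist_eq_norm] using hz)
    (Metric.mem_closedBall_self (norm_nonneg _)) (y := x) (by simp [dist_eq_norm])
  rw [minValue_eq hy]
  calc U x - U y ≤ ‖U x - U y‖ := le_abs_self _
    _ ≤ _ := h
    _ = _ := by ring

lemma integrable_exp_of_le (hU : IsPotential U L a₀) (ha : a₀ ≤ a) :
    Integrable (fun x => Real.exp (-(a * (U x - minValue U)))) := by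
  have h0 : Integrable (fun x => Real.exp (-(a₀ * (U x - minValue U)))) := by
    have := hU.integrable_exp.const_mul (Real.exp (a₀ * minValue U))
    refine this.congr (Filter.Eventually.of_forall fun x => ?_)
    simp only [← Real.exp_add]
    congr 1; ring
  have hc := hU.differentiable.continuous
  refine h0.mono' (by fun_prop) (Filter.Eventually.of_forall fun x => ?_)
  rw [Real.norm_eq_abs, abs_of_pos (Real.exp_pos _), Real.exp_le_exp, neg_le_neg_iff]
  exact mul_le_mul_of_nonneg_right ha (sub_nonneg.2 (hU.minValue_le x))

lemma integral_exp_pos (hU : IsPotential U L a₀) (ha : a₀ ≤ a) :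
    0 < ∫ x, Real.exp (-(a * (U x - minValue U))) :=
  MeasureTheory.integral_exp_pos (integrable_exp_of_le hU ha)

/-- With the minimum shifted to zero the exponential decreases in `a`, so bounds at `a₀` pass to all
`a ≥ a₀`. -/
lemma gibbsDensity_eq (a : ℝ) (x : E d) :
    gibbsDensity U a x = Real.exp (-(a * (U x - minValue U))) /
      ∫ y, Real.exp (-(a * (U y - minValue U))) := by
  have h : ∀ y, Real.exp (-(a * (U y - minValue U)))
      = Real.exp (a * minValue U) * Real.exp (-(a * U y)) := fun y => by
    rw [← Real.exp_add]; congr 1; ring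
  simp only [gibbsDensity, h, integral_const_mul]
  rw [mul_div_mul_left _ _ (Real.exp_pos _).ne']

lemma integrable_gibbsDensity (hU : IsPotential U L a₀) (ha : a₀ ≤ a) :
    Integrable (gibbsDensity U a) := by
  simp only [funext (gibbsDensity_eq (U := U) a)]
  exact (integrable_exp_of_le hU ha).div_const _

lemma gibbsDensity_pos (hU : IsPotential U L a₀) (ha : a₀ ≤ a) (x : E d) :
    0 < gibbsDensity U a x := by
  rw [gibbsDensity_eq]
  exact div_pos (Real.exp_pos _) (integral_exp_pos hU ha)

lemma isProbabilityMeasure_densityMeasure {p : E d → ℝ} (hp : Integrable p)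
    (h0 : ∀ x, 0 ≤ p x) (h1 : ∫ x, p x = 1) : IsProbabilityMeasure (densityMeasure p) := by
  constructor
  rw [densityMeasure, withDensity_apply _ MeasurableSet.univ, Measure.restrict_univ,
    ← ofReal_integral_eq_lintegral_ofReal hp (Filter.Eventually.of_forall h0), h1,
    ENNReal.ofReal_one]

lemma isProbabilityMeasure_gibbs (hU : IsPotential U L a₀) (ha : a₀ ≤ a) :
    IsProbabilityMeasure (gibbs U a) := by
  refine isProbabilityMeasure_densityMeasure (integrable_gibbsDensity hU ha)
    (fun x => (gibbsDensity_pos hU ha x).le) ?_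
  simp only [gibbsDensity_eq, integral_div]
  exact div_self (integral_exp_pos hU ha).ne'

/-! ### The entropy inequality for events -/

/-- Fenchel–Young inequality for `klFun` at slope one: the gap between the two sides is `e * klFun
(x / e)`. -/
lemma le_klFun_add {x : ℝ} (hx : 0 ≤ x) : x ≤ klFun x + (Real.exp 1 - 1) := by
  have h := klFun_nonneg (x := x / Real.exp 1) (by positivity)
  have he := Real.exp_pos 1
  rcases hx.eq_or_lt with rfl | hx
  · simp [klFun_zero, he.le]
  rw [klFun_apply, Real.log_div hx.ne' he.ne', Real.log_exp] at h
  have h2 := mul_nonneg he.le h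
  have h3 : Real.exp 1 * (x / Real.exp 1 * (Real.log x - 1) + 1 - x / Real.exp 1)
    = x * (Real.log x - 1) + Real.exp 1 - x := by field_simp
  rw [h3] at h2
  rw [klFun_apply]
  linarith

/-- The scalar inequality for the density, integrated over `A`; without absolute continuity the
divergence is infinite. -/
lemma measure_le_klDiv_add {α : Type*} [MeasurableSpace α] (ν μ : Measure α) [IsFiniteMeasure ν]
    [IsFiniteMeasure μ] (A : Set α) :
    ν A ≤ klDiv ν μ + ENNReal.ofReal (Real.exp 1 - 1) * μ A := by
  by_cases hac : ν ≪ μ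
  swap
  · simp [klDiv_of_not_ac hac]
  rw [klDiv_eq_lintegral_klFun_of_ac hac]
  have h1 : ν A = ∫⁻ x in A, ν.rnDeriv μ x ∂μ := (Measure.setLIntegral_rnDeriv hac A).symm
  rw [h1]
  calc ∫⁻ x in A, ν.rnDeriv μ x ∂μ
      ≤ ∫⁻ x in A, (ENNReal.ofReal (klFun (ν.rnDeriv μ x).toReal)
          + ENNReal.ofReal (Real.exp 1 - 1)) ∂μ := by
        refine lintegral_mono_ae (ae_restrict_of_ae ?_)
        filter_upwards [Measure.rnDeriv_lt_top ν μ] with x hx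
        rw [← ENNReal.ofReal_add (klFun_nonneg ENNReal.toReal_nonneg)
          (by linarith [Real.add_one_le_exp (1 : ℝ)])]
        conv_lhs => rw [← ENNReal.ofReal_toReal hx.ne]
        exact ENNReal.ofReal_le_ofReal (le_klFun_add ENNReal.toReal_nonneg)
    _ ≤ _ := by
        rw [lintegral_add_right _ measurable_const]
        refine add_le_add (setLIntegral_le_lintegral _ _) ?_
        simp

/-! ### The optimization guarantee -/

lemma limitMeasure_compl (hU : IsPotential U L a₀) :
    limitMeasure U (globalMinimizers U)ᶜ = 0 := by
  have hm := hU.finite_minimizers.measurableSet.compl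
  rw [limitMeasure, Measure.sum_apply _ hm]
  simp [hm]

lemma exists_coupling {μ ν : Measure (E d)} {K : ℝ≥0∞} (h : W2 μ ν ^ 2 < K) :
    ∃ ζ ∈ couplings μ ν, ∫⁻ z, ENNReal.ofReal (‖z.1 - z.2‖ ^ 2) ∂ζ < K := by
  rw [W2, ← ENNReal.rpow_natCast, ← ENNReal.rpow_mul] at h
  simpa [iInf_lt_iff] using h

lemma gibbs_le_half (hU : IsPotential U L a₀) {C ε : ℝ} (hC : 0 < C)
    (hW : WassersteinRate U a₀ C) (hε : 0 < ε)
    (ha : max a₀ (9 * C ^ 4 * (L : ℝ) ^ 2 / ε ^ 2) ≤ a) :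
    gibbs U a {x | ε ≤ U x - minValue U} ≤ ENNReal.ofReal (1 / 2) := by
  have ha0 : a₀ ≤ a := (le_max_left _ _).trans ha
  have ha1 := (le_max_right _ _).trans ha
  have hapos : 0 < a := hU.a₀_pos.trans_le ha0
  set s : ℝ := a ^ (-(1 / 4) : ℝ) with hs
  have hspos : 0 < s := Real.rpow_pos_of_pos hapos _
  have hs4 : s ^ 4 * a = 1 := by
    rw [hs, ← Real.rpow_natCast, ← Real.rpow_mul hapos.le]
    norm_num [Real.rpow_neg_one]
    exact inv_mul_cancel₀ hapos.ne'
  -- The threshold on `a` is this inequality squared, because `s ^ 4 = 1 / a`.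
  have hkey : L * (C * s) ^ 2 ≤ ε / 3 := by
    rw [div_le_iff₀ (by positivity)] at ha1
    have h1 : (L * (C * s) ^ 2) ^ 2 ≤ (ε / 3) ^ 2 := by
      have : 9 * C ^ 4 * (L : ℝ) ^ 2 * s ^ 4 ≤ ε ^ 2 := by
        calc 9 * C ^ 4 * (L : ℝ) ^ 2 * s ^ 4 ≤ a * ε ^ 2 * s ^ 4 := by gcongr
          _ = ε ^ 2 * (s ^ 4 * a) := by ring
          _ = ε ^ 2 := by rw [hs4, mul_one]
      nlinarith
    exact (sq_le_sq₀ (by positivity) (by positivity)).1 h1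
  -- The factor `3 / 2` provides the strict inequality that selects a coupling without knowing that
  -- the infimum is attained; then `3 / 2 * (ε / 3) = ε / 2`.
  have hW2 : W2 (gibbs U a) (limitMeasure U) ^ 2
      < ENNReal.ofReal (3 / 2 * (C * s) ^ 2) := by
    refine lt_of_le_of_lt (pow_le_pow_left' (hW a ha0) 2) ?_
    rw [← ENNReal.ofReal_pow (by positivity), ENNReal.ofReal_lt_ofReal_iff (by positivity)]
    have : 0 < (C * s) ^ 2 := by positivity
    linarith
  obtain ⟨ζ, ⟨hζ1, hζ2⟩, hζ⟩ := exists_coupling hW2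
  have hcont := hU.differentiable.continuous
  have hint : ∫⁻ x, ENNReal.ofReal (U x - minValue U) ∂(gibbs U a) ≤ ENNReal.ofReal (ε / 2) := by
    rw [← hζ1, lintegral_map (by fun_prop) measurable_fst]
    calc ∫⁻ z, ENNReal.ofReal (U z.1 - minValue U) ∂ζ
        ≤ ∫⁻ z, ENNReal.ofReal L * ENNReal.ofReal (‖z.1 - z.2‖ ^ 2) ∂ζ := by
          refine lintegral_mono_ae ?_
          have h2 : ∀ᵐ z ∂ζ, z.2 ∈ globalMinimizers U := by
            refine ae_of_ae_map (f := Prod.snd) (p := fun y => y ∈ globalMinimizers U)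
              measurable_snd.aemeasurable ?_
            rw [hζ2]
            exact limitMeasure_compl hU
          filter_upwards [h2] with z hz
          rw [← ENNReal.ofReal_mul L.coe_nonneg]
          exact ENNReal.ofReal_le_ofReal (sub_minValue_le hU hz z.1)
      _ = ENNReal.ofReal L * ∫⁻ z, ENNReal.ofReal (‖z.1 - z.2‖ ^ 2) ∂ζ :=
          lintegral_const_mul' _ _ ENNReal.ofReal_ne_top
      _ ≤ ENNReal.ofReal L * ENNReal.ofReal (3 / 2 * (C * s) ^ 2) := by gcongr
      _ ≤ _ := by
          rw [← ENNReal.ofReal_mul L.coe_nonneg]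
          refine ENNReal.ofReal_le_ofReal ?_
          linarith
  have hmarkov := mul_meas_ge_le_lintegral (μ := gibbs U a)
    (f := fun x => ENNReal.ofReal (U x - minValue U)) (by fun_prop) (ENNReal.ofReal ε)
  have hset : {x | ENNReal.ofReal ε ≤ ENNReal.ofReal (U x - minValue U)}
      = {x | ε ≤ U x - minValue U} := by
    ext x
    simp only [Set.mem_ofPred_eq]
    exact ENNReal.ofReal_le_ofReal_iff (sub_nonneg.2 (hU.minValue_le x))
  rw [hset] at hmarkov
  have h3 := hmarkov.trans hint
  rw [show ε / 2 = ε * (1 / 2) by ring, ENNReal.ofReal_mul hε.le] at h3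
  exact (ENNReal.mul_le_mul_iff_right (by simpa using hε) ENNReal.ofReal_ne_top).1 h3

lemma pow_le_of_log_le {δ ε : ℝ} {N : ℕ} (hε : 0 < ε) (hε' : ε < 1 / 2) (hδ : 0 < δ) (hδ' : δ < 1)
    (hN : 18 * Real.log (1 / δ) / ε ^ 2 ≤ (N : ℝ)) : (9 / 10 : ℝ) ^ N ≤ δ := by
  have hlog : 0 < Real.log (1 / δ) := Real.log_pos (by rw [lt_div_iff₀ hδ]; linarith)
  -- From `ε ^ 2 ≤ 1 / 4`. Since `log (9 / 10) ≤ -1 / 10`, the factor `10` would already suffice.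
  have h1 : 72 * Real.log (1 / δ) ≤ N := by
    refine le_trans ?_ hN
    rw [le_div_iff₀ (by positivity)]
    have : ε ^ 2 ≤ 1 / 4 := by nlinarith
    nlinarith
  have h2 : Real.log (9 / 10) ≤ -(1 / 10) := by
    have := Real.log_le_sub_one_of_pos (show (0 : ℝ) < 9 / 10 by norm_num)
    linarith
  rw [← Real.log_le_log_iff (by positivity) hδ, Real.log_pow]
  rw [one_div, Real.log_inv] at h1 hlog
  nlinarith

theorem algorithm_guarantee (hU : IsPotential U L a₀) {C ε δ : ℝ} (hC : 0 < C)
    (hW : WassersteinRate U a₀ C) (hε : 0 < ε) (hε' : ε < 1 / 2) (hδ : 0 < δ) (hδ' : δ < 1)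
    (ha : max a₀ (9 * C ^ 4 * (L : ℝ) ^ 2 / ε ^ 2) ≤ a) {N : ℕ}
    (hN : 18 * Real.log (1 / δ) / ε ^ 2 ≤ (N : ℝ)) (μt : Measure (E d)) [IsProbabilityMeasure μt]
    (hKL : klDiv μt (gibbs U a) ≤ ENNReal.ofReal (ε ^ 2 / 18))
    {Ω : Type*} [MeasurableSpace Ω] (P : Measure Ω) [IsProbabilityMeasure P] (Xout : Ω → E d)
    (hX : IsAlgorithmOutput P U μt N Xout) :
    P {ω | ε ≤ U (Xout ω) - minValue U} ≤ ENNReal.ofReal δ := by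
  obtain ⟨X, I, hmeas, hlaw, hindep, hI, hout⟩ := hX
  have hcont := hU.differentiable.continuous
  set A : Set (E d) := {x | ε ≤ U x - minValue U} with hA
  have hAm : MeasurableSet A := measurableSet_le measurable_const (by fun_prop)
  have := isProbabilityMeasure_gibbs hU ((le_max_left _ _).trans ha)
  have hμt : μt A ≤ ENNReal.ofReal (9 / 10) := by
    refine (measure_le_klDiv_add μt (gibbs U a) A).trans ?_
    calc _ ≤ ENNReal.ofReal (ε ^ 2 / 18)
          + ENNReal.ofReal (Real.exp 1 - 1) * ENNReal.ofReal (1 / 2) := by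
          gcongr
          exact gibbs_le_half hU hC hW hε ha
      -- Here `ε ^ 2 / 18 < 1 / 72` and `(e - 1) / 2 < 0.86`.
      _ ≤ _ := by
          have he := Real.exp_one_lt_d9
          have he' : 0 ≤ Real.exp 1 - 1 := by linarith [Real.add_one_le_exp (1 : ℝ)]
          rw [← ENNReal.ofReal_mul he', ← ENNReal.ofReal_add (by positivity) (by positivity)]
          refine ENNReal.ofReal_le_ofReal ?_
          nlinarith
  have hsub : {ω | ε ≤ U (Xout ω) - minValue U} ⊆ ⋂ i ∈ Finset.univ, X i ⁻¹' A := by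
    intro ω hω
    simp only [Set.mem_iInter, Set.mem_preimage, hA, Set.mem_ofPred_eq] at hω ⊢
    intro i _
    rw [hout] at hω
    linarith [hI ω i]
  refine (measure_mono hsub).trans ?_
  rw [hindep.measure_inter_preimage_eq_mul Finset.univ (sets := fun _ => A) fun _ _ => hAm]
  calc ∏ i, P (X i ⁻¹' A) ≤ ∏ _i : Fin N, ENNReal.ofReal (9 / 10) := by
        refine Finset.prod_le_prod' fun i _ => ?_
        rw [← Measure.map_apply (hmeas i) hAm, hlaw i]
        exact hμt
    _ = ENNReal.ofReal ((9 / 10) ^ N) := by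
        rw [Finset.prod_const, Finset.card_univ, Fintype.card_fin,
          ENNReal.ofReal_pow (by norm_num)]
    _ ≤ _ := ENNReal.ofReal_le_ofReal (pow_le_of_log_le hε hε' hδ hδ' hN)

/-! ### The log-Sobolev inequality gives a finite second moment -/

/-- A bounded smooth approximation of `1 + ‖x‖² / K`. -/
noncomputable def tilt {d : ℕ} (K η : ℝ) (x : E d) : ℝ := 1 + ‖x‖ ^ 2 / (K + η * ‖x‖ ^ 2)

lemma one_le_tilt {K η : ℝ} (hK : 0 < K) (hη : 0 < η) (x : E d) : 1 ≤ tilt K η x := by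
  have : 0 ≤ ‖x‖ ^ 2 / (K + η * ‖x‖ ^ 2) := by positivity
  unfold tilt; linarith

lemma tilt_le {K η : ℝ} (hK : 0 < K) (hη : 0 < η) (x : E d) : tilt K η x ≤ 1 + 1 / η := by
  unfold tilt
  gcongr 1 + ?_
  rw [div_le_div_iff₀ (by positivity) hη]
  nlinarith

lemma tilt_le_of_norm_le {K η R : ℝ} (hK : 0 < K) (hη : 0 < η) {x : E d} (hx : ‖x‖ ≤ R) :
    tilt K η x ≤ 1 + R ^ 2 / K := by
  unfold tilt
  gcongr
  nlinarith [norm_nonneg x, mul_nonneg hη.le (sq_nonneg ‖x‖)]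

lemma contDiff_tilt {K η : ℝ} (hK : 0 < K) (hη : 0 < η) :
    ContDiff ℝ 1 (tilt K η : E d → ℝ) := by
  have h := contDiff_norm_sq ℝ (E := E d) (n := 1)
  unfold tilt
  refine contDiff_const.add (h.div (contDiff_const.add (contDiff_const.mul h)) fun x => ?_)
  positivity

lemma hasFDerivAt_log_add_norm_sq {K c : ℝ} (hK : 0 < K) (hc : 0 ≤ c) (x : E d) :
    HasFDerivAt (fun z : E d => Real.log (K + c * ‖z‖ ^ 2))
      ((K + c * ‖x‖ ^ 2)⁻¹ • c • (2 • innerSL ℝ x)) x := by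
  have h := ((hasStrictFDerivAt_norm_sq x).hasFDerivAt.const_mul c).const_add K
  exact h.log (by positivity)

/-- By AM-GM, `(K + c ‖x‖²)² ≥ 4 K c ‖x‖²`, so the squared norm is at most `c / K`. -/
lemma norm_fderiv_log_add_norm_sq_le {K c : ℝ} (hK : 0 < K) (hc : 0 ≤ c) (hc2 : c ≤ 2) (x : E d) :
    ‖(K + c * ‖x‖ ^ 2)⁻¹ • c • (2 • innerSL ℝ x)‖ ≤ √(2 / K) := by
  rw [norm_smul, norm_smul, ← Nat.cast_smul_eq_nsmul ℝ, norm_smul, innerSL_apply_norm, norm_inv,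
    Real.norm_of_nonneg (show 0 ≤ K + c * ‖x‖ ^ 2 by positivity), Real.norm_of_nonneg hc]
  refine Real.le_sqrt_of_sq_le ?_
  have h1 : (K + c * ‖x‖ ^ 2)⁻¹ * (c * (‖((2 : ℕ) : ℝ)‖ * ‖x‖))
      = 2 * c * ‖x‖ / (K + c * ‖x‖ ^ 2) := by
    simp only [Nat.cast_ofNat, Real.norm_ofNat]
    field_simp
  rw [h1, div_pow, div_le_div_iff₀ (by positivity) hK]
  have h2 : 0 ≤ c * ‖x‖ ^ 2 * K := by positivity
  nlinarith [sq_nonneg (K - c * ‖x‖ ^ 2), mul_nonneg (sub_nonneg.2 hc2) h2]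

/-- The logarithm of the tilt is a difference of two terms with gradient at most `√(2 / K)` each, so
the bound is uniform in `η`. -/
lemma norm_gradient_log_tilt_le {K η H : ℝ} (hK : 0 < K) (hη : 0 < η) (hη1 : η ≤ 1) (hH : 0 < H)
    (x : E d) : ‖gradient (fun z => Real.log (tilt K η z / H)) x‖ ^ 2 ≤ 8 / K := by
  have heq : (fun z : E d => Real.log (tilt K η z / H)) = fun z =>
      Real.log (K + (1 + η) * ‖z‖ ^ 2) - Real.log (K + η * ‖z‖ ^ 2) - Real.log H := by
    ext z
    have h1 : 0 < K + η * ‖z‖ ^ 2 := by positivity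
    have h2 : 0 < K + (1 + η) * ‖z‖ ^ 2 := by positivity
    rw [← Real.log_div h2.ne' h1.ne', ← Real.log_div (by positivity) hH.ne']
    congr 2
    unfold tilt
    field_simp
    ring
  have hd := (((hasFDerivAt_log_add_norm_sq hK (show 0 ≤ 1 + η by linarith) x).sub
    (hasFDerivAt_log_add_norm_sq hK hη.le x)).sub_const (Real.log H)).congr_of_eventuallyEq
    (Filter.EventuallyEq.of_eq heq)
  rw [gradient, LinearIsometryEquiv.norm_map, hd.fderiv]
  have h1 := norm_fderiv_log_add_norm_sq_le hK (show 0 ≤ 1 + η by linarith) (by linarith) x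
  have h2 := norm_fderiv_log_add_norm_sq_le hK hη.le (by linarith) x
  calc _ ≤ (√(2 / K) + √(2 / K)) ^ 2 := by
        gcongr
        exact (norm_sub_le _ _).trans (add_le_add h1 h2)
    _ = 4 * √(2 / K) ^ 2 := by ring
    _ = _ := by rw [Real.sq_sqrt (by positivity)]; ring

lemma contDiff_gibbsDensity (hU : IsPotential U L a₀) : ContDiff ℝ 1 (gibbsDensity U a) := by
  have h : ContDiff ℝ 1 U :=
    contDiff_one_iff_fderiv.2 ⟨hU.differentiable, hU.twice_differentiable.continuous⟩
  unfold gibbsDensity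
  fun_prop

/-- The normalized tilt of the Gibbs measure has small Fisher information, hence small entropy, so
it keeps half of its mass in the ball. There its density is at most `(1 + R² / K) / H` times the
Gibbs density, which bounds the normalization `H`. -/
lemma integral_tilt_le (hU : IsPotential U L a₀) (ha : a₀ ≤ a) {ρ R : ℝ} (hρ : 0 < ρ)
    (hLS : LogSobolev (gibbsDensity U a) ρ)
    (hR : gibbs U a (Metric.closedBall 0 R)ᶜ ≤ ENNReal.ofReal (1 / 8)) {η : ℝ} (hη : 0 < η)
    (hη1 : η ≤ 1) :
    Integrable (fun x => tilt (16 / ρ) η x * gibbsDensity U a x) ∧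
    ∫ x, tilt (16 / ρ) η x * gibbsDensity U a x ≤ 2 * (1 + R ^ 2 / (16 / ρ)) := by
  set K : ℝ := 16 / ρ with hKdef
  have hK : 0 < K := by positivity
  set q := gibbsDensity U a
  have hq := integrable_gibbsDensity hU ha
  have hq0 : ∀ x, 0 < q x := gibbsDensity_pos hU ha
  have ht1 : ∀ x : E d, 1 ≤ tilt K η x := one_le_tilt hK hη
  have ht0 : ∀ x : E d, 0 < tilt K η x := fun x => zero_lt_one.trans_le (ht1 x)
  have hint : Integrable (fun x => tilt K η x * q x) := by
    refine hq.bdd_mul (c := 1 + 1 / η) (contDiff_tilt hK hη).continuous.aestronglyMeasurable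
      (Filter.Eventually.of_forall fun x => ?_)
    rw [Real.norm_of_nonneg (ht0 x).le]
    exact tilt_le hK hη x
  refine ⟨hint, ?_⟩
  have := isProbabilityMeasure_gibbs hU ha
  set H := ∫ x, tilt K η x * q x with hH
  have hq1 : ∫ x, q x = 1 := by
    simp only [q, gibbsDensity_eq, integral_div]
    exact div_self (integral_exp_pos hU ha).ne'
  have hHpos : 0 < H := by
    have : ∫ x, q x ≤ H := integral_mono hq hint fun x => le_mul_of_one_le_left (hq0 x).le (ht1 x)
    linarith
  set p : E d → ℝ := fun x => tilt K η x * q x / H with hp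
  have hp0 : ∀ x, 0 < p x := fun x => div_pos (mul_pos (ht0 x) (hq0 x)) hHpos
  have hpint : Integrable p := hint.div_const H
  have hpp : IsProbabilityMeasure (densityMeasure p) := by
    refine isProbabilityMeasure_densityMeasure hpint (fun x => (hp0 x).le) ?_
    rw [hp, integral_div]
    exact div_self hHpos.ne'
  have hKL := hLS p (((contDiff_tilt hK hη).mul (contDiff_gibbsDensity hU)).div_const H) hp0 hpp
  have hFI : fisherInfo p q ≤ ENNReal.ofReal (8 / K) := by
    have hpq : ∀ z, p z / q z = tilt K η z / H := fun z => by
      have := (hq0 z).ne'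
      simp only [hp]; field_simp
    calc fisherInfo p q ≤ ∫⁻ _, ENNReal.ofReal (8 / K) ∂(densityMeasure p) := by
          refine lintegral_mono fun x => ENNReal.ofReal_le_ofReal ?_
          simp only [hpq]
          exact norm_gradient_log_tilt_le hK hη hη1 hHpos x
      _ = _ := by simp
  -- The choice `K = 16 / ρ` makes `1 / (2 * ρ) * (8 / K)` equal to `1 / 4`.
  have hKL' : klDiv (densityMeasure p) (gibbs U a) ≤ ENNReal.ofReal (1 / 4) := by
    refine hKL.trans ((mul_le_mul_right hFI _).trans ?_)
    rw [← ENNReal.ofReal_mul (by positivity)]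
    refine ENNReal.ofReal_le_ofReal (le_of_eq ?_)
    rw [hKdef]; field_simp; norm_num
  set A : Set (E d) := (Metric.closedBall 0 R)ᶜ with hA
  -- Numerically, `1 / 4 + (e - 1) / 8 < 1 / 2`.
  have hνA : densityMeasure p A ≤ ENNReal.ofReal (1 / 2) := by
    refine (measure_le_klDiv_add _ (gibbs U a) A).trans ?_
    refine (add_le_add hKL' (mul_le_mul_right hR _)).trans ?_
    have he := Real.exp_one_lt_d9
    have he' : 0 ≤ Real.exp 1 - 1 := by linarith [Real.add_one_le_exp (1 : ℝ)]
    rw [← ENNReal.ofReal_mul he', ← ENNReal.ofReal_add (by positivity) (by positivity)]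
    refine ENNReal.ofReal_le_ofReal ?_
    linarith
  have hνA' : densityMeasure p Aᶜ ≤ ENNReal.ofReal ((1 + R ^ 2 / K) / H) := by
    rw [hA, compl_compl, densityMeasure,
      withDensity_apply _ Metric.isClosed_closedBall.measurableSet]
    calc ∫⁻ x in Metric.closedBall 0 R, ENNReal.ofReal (p x)
        ≤ ∫⁻ x in Metric.closedBall 0 R,
            ENNReal.ofReal ((1 + R ^ 2 / K) / H) * ENNReal.ofReal (q x) := by
          refine setLIntegral_mono' Metric.isClosed_closedBall.measurableSet fun x hx => ?_
          rw [← ENNReal.ofReal_mul (by positivity)]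
          refine ENNReal.ofReal_le_ofReal ?_
          have := tilt_le_of_norm_le hK hη (mem_closedBall_zero_iff.1 hx)
          calc p x = tilt K η x * (q x / H) := by simp only [hp]; ring
            _ ≤ (1 + R ^ 2 / K) * (q x / H) :=
              mul_le_mul_of_nonneg_right this (div_pos (hq0 x) hHpos).le
            _ = _ := by ring
      _ = ENNReal.ofReal ((1 + R ^ 2 / K) / H) *
            ∫⁻ x in Metric.closedBall 0 R, ENNReal.ofReal (q x) :=
          lintegral_const_mul' _ _ ENNReal.ofReal_ne_top
      _ ≤ ENNReal.ofReal ((1 + R ^ 2 / K) / H) * 1 := by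
          gcongr
          refine (setLIntegral_le_lintegral _ _).trans ?_
          rw [← ofReal_integral_eq_lintegral_ofReal hq
            (Filter.Eventually.of_forall fun x => (hq0 x).le), hq1, ENNReal.ofReal_one]
      _ = _ := mul_one _
  have hsum : (1 : ℝ≥0∞) ≤ ENNReal.ofReal (1 / 2 + (1 + R ^ 2 / K) / H) := by
    rw [ENNReal.ofReal_add (by norm_num) (by positivity)]
    have hAm : MeasurableSet A := Metric.isClosed_closedBall.measurableSet.compl
    rw [← hpp.measure_univ, ← measure_add_measure_compl hAm]
    exact add_le_add hνA hνA'
  rw [ENNReal.one_le_ofReal] at hsum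
  have h2 : 1 / 2 ≤ (1 + R ^ 2 / K) / H := by linarith
  rw [le_div_iff₀ hHpos] at h2
  linarith

lemma exists_measure_compl_closedBall_le (μ : Measure (E d)) [IsFiniteMeasure μ] {ε : ℝ≥0∞}
    (hε : 0 < ε) : ∃ R : ℝ, μ (Metric.closedBall 0 R)ᶜ ≤ ε := by
  have h := tendsto_measure_compl_closedBall_of_isTightMeasureSet
    (isTightMeasureSet_singleton (μ := μ)) (0 : E d)
  simp only [Set.mem_singleton_iff, iSup_iSup_eq_left] at h
  obtain ⟨R, hR⟩ := (h.eventually (ge_mem_nhds hε)).exists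
  exact ⟨R, hR⟩

/-- The bound on the tilted integrals does not depend on `η`, so Fatou's lemma applies as `η → 0`.
-/
theorem integrable_norm_sq_mul_gibbsDensity (hU : IsPotential U L a₀)
    (hLSI : GibbsLogSobolev U a₀) (ha : a₀ ≤ a) :
    Integrable (fun x => ‖x‖ ^ 2 * gibbsDensity U a x) := by
  obtain ⟨ρ, hρ, hLS⟩ := hLSI a ha
  have := isProbabilityMeasure_gibbs hU ha
  obtain ⟨R, hR⟩ := exists_measure_compl_closedBall_le (gibbs U a)
    (ε := ENNReal.ofReal (1 / 8)) (by simp)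
  have hq0 := gibbsDensity_pos hU ha
  set K : ℝ := 16 / ρ
  have hK : 0 < K := by positivity
  set B := 2 * (1 + R ^ 2 / K)
  set η : ℕ → ℝ := fun n => 1 / ((n : ℝ) + 1)
  have hη : ∀ n, 0 < η n := fun n => by positivity
  have hη1 : ∀ n, η n ≤ 1 := fun n => by
    simp only [η]; rw [div_le_one (by positivity)]; linarith [n.cast_nonneg (α := ℝ)]
  have hηlim : Filter.Tendsto η Filter.atTop (nhds 0) := tendsto_one_div_add_atTop_nhds_zero_nat
  have hcont : Continuous (gibbsDensity U a) := (contDiff_gibbsDensity hU).continuous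
  have hn : ∀ n, ∫⁻ x, ENNReal.ofReal (tilt K (η n) x * gibbsDensity U a x) ≤ ENNReal.ofReal B := by
    intro n
    obtain ⟨h1, h2⟩ := integral_tilt_le hU ha hρ hLS hR (hη n) (hη1 n)
    rw [← ofReal_integral_eq_lintegral_ofReal h1 (Filter.Eventually.of_forall fun x => ?_)]
    · exact ENNReal.ofReal_le_ofReal h2
    · exact mul_nonneg (zero_le_one.trans (one_le_tilt hK (hη n) x)) (hq0 x).le
  have hlim : ∫⁻ x, ENNReal.ofReal ((1 + ‖x‖ ^ 2 / K) * gibbsDensity U a x)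
      ≤ ENNReal.ofReal B := by
    have hpt : ∀ x : E d, ENNReal.ofReal ((1 + ‖x‖ ^ 2 / K) * gibbsDensity U a x)
        = Filter.liminf (fun n => ENNReal.ofReal (tilt K (η n) x * gibbsDensity U a x))
          Filter.atTop := by
      intro x
      refine (Filter.Tendsto.liminf_eq ?_).symm
      refine ENNReal.tendsto_ofReal (Filter.Tendsto.mul_const _ ?_)
      have h1 : Filter.Tendsto (fun n => 1 + ‖x‖ ^ 2 / (K + η n * ‖x‖ ^ 2)) Filter.atTop
          (nhds (1 + ‖x‖ ^ 2 / (K + 0 * ‖x‖ ^ 2))) := by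
        refine tendsto_const_nhds.add (tendsto_const_nhds.div
          (tendsto_const_nhds.add (hηlim.mul_const _)) (by simpa using hK.ne'))
      simpa [tilt] using h1
    simp only [hpt]
    refine (lintegral_liminf_le fun n => ?_).trans ?_
    · have := (contDiff_tilt (d := d) hK (hη n)).continuous
      fun_prop
    · exact Filter.liminf_le_of_le (by isBoundedDefault) fun b hb =>
        let ⟨n, hn'⟩ := hb.exists; hn'.trans (hn n)
  have hI : Integrable (fun x => (1 + ‖x‖ ^ 2 / K) * gibbsDensity U a x) := by
    refine ⟨by fun_prop, ?_⟩
    rw [hasFiniteIntegral_iff_ofReal (Filter.Eventually.of_forall fun x =>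
      mul_nonneg (by positivity) (hq0 x).le)]
    exact hlim.trans_lt ENNReal.ofReal_lt_top
  refine ((hI.sub (integrable_gibbsDensity hU ha)).const_mul K).congr
    (Filter.Eventually.of_forall fun x => ?_)
  simp only [Pi.sub_apply]
  field_simp
  ring

/-! ### The quadratic model at a minimizer -/

/-- The second derivative of `U` at `x`, as a quadratic form. -/
noncomputable def hessForm (U : E d → ℝ) (x v : E d) : ℝ := fderiv ℝ (fderiv ℝ U) x v v

lemma continuous_hessForm (x : E d) : Continuous (hessForm U x) := by
  unfold hessForm
  fun_prop

lemma hessForm_smul (x : E d) (t : ℝ) (v : E d) :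
    hessForm U x (t • v) = t ^ 2 * hessForm U x v := by
  simp only [hessForm, map_smul, _root_.smul_apply, smul_eq_mul]
  ring

open Matrix in
lemma hessForm_eq_dotProduct (x v : E d) :
    hessForm U x v = v.ofLp ⬝ᵥ (hessianMatrix U x *ᵥ v.ofLp) := by
  have hv : v = ∑ i, v i • EuclideanSpace.single i (1 : ℝ) := by
    conv_lhs => rw [← (EuclideanSpace.basisFun (Fin d) ℝ).sum_repr v]
    simp
  conv_lhs => rw [hessForm, hv]
  simp only [map_sum, map_smul, _root_.sum_apply, _root_.smul_apply,
    smul_eq_mul, dotProduct, mulVec, hessianMatrix, Matrix.of_apply, Finset.mul_sum]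
  rw [Finset.sum_comm]
  exact Finset.sum_congr rfl fun i _ => Finset.sum_congr rfl fun j _ => by ring

open scoped MatrixOrder ComplexOrder Matrix.Norms.L2Operator in
-- Factor the Hessian as `Bᵀ B`; then its determinant is `(det B) ^ 2`.
lemma exists_linearMap_hessForm {x : E d} (hx : (hessianMatrix U x).PosDef) :
    ∃ B : E d →ₗ[ℝ] E d, LinearMap.det B ≠ 0 ∧ (∀ v, hessForm U x v = ‖B v‖ ^ 2) ∧
      laplaceWeight U x = |(LinearMap.det B)⁻¹| := by
  obtain ⟨B, hB⟩ := CStarAlgebra.nonneg_iff_eq_star_mul_self.mp hx.posSemidef.nonneg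
  have hdet : (hessianMatrix U x).det = B.det ^ 2 := by
    rw [hB, Matrix.det_mul, Matrix.star_eq_conjTranspose, Matrix.det_conjTranspose]
    simp [sq]
  refine ⟨B.toLpLin 2 2, ?_, fun v => ?_, ?_⟩
  · rw [LinearMap.det_toLpLin]
    intro h0
    have := hx.det_pos
    rw [hdet, h0] at this
    simp at this
  · rw [hessForm_eq_dotProduct, hB, ← Matrix.mulVec_mulVec, Matrix.star_eq_conjTranspose,
      Matrix.dotProduct_mulVec, Matrix.vecMul_conjTranspose, EuclideanSpace.real_norm_sq_eq]
    simp [dotProduct, Matrix.toLpLin_apply, sq]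
  · rw [LinearMap.det_toLpLin, laplaceWeight, hdet, Real.sqrt_sq_eq_abs, abs_inv]

lemma laplaceWeight_pos {x : E d} (hx : (hessianMatrix U x).PosDef) : 0 < laplaceWeight U x :=
  inv_pos.2 (Real.sqrt_pos.2 hx.det_pos)

/-- The factor `B` is injective in finite dimension, hence bounded below. -/
lemma exists_le_hessForm {x : E d} (hx : (hessianMatrix U x).PosDef) :
    ∃ c : ℝ, 0 < c ∧ ∀ v, c * ‖v‖ ^ 2 ≤ hessForm U x v := by
  obtain ⟨B, hB, hQ, -⟩ := exists_linearMap_hessForm hx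
  have hker : LinearMap.ker B = ⊥ := by
    have := (LinearEquiv.ofIsUnitDet (f := B) (v := Module.finBasis ℝ (E d))
      (v' := Module.finBasis ℝ (E d)) (by
        rw [LinearMap.det_toMatrix]; exact hB.isUnit)).ker
    exact this
  obtain ⟨K, hK, hlip⟩ := B.exists_antilipschitzWith hker
  refine ⟨((K : ℝ) ^ 2)⁻¹, by positivity, fun v => ?_⟩
  have h := hlip.le_mul_dist v 0
  rw [map_zero, dist_zero_right, dist_zero_right] at h
  have hK' : (0 : ℝ) < K := hK
  rw [hQ, inv_mul_le_iff₀ (by positivity), ← mul_pow]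
  gcongr

/-- The integral of the standard Gaussian function. -/
noncomputable def gaussianMass (d : ℕ) : ℝ := ∫ z : E d, Real.exp (-(‖z‖ ^ 2 / 2))

/-- Substitute `z = B v`. The constant `gaussianMass d` is never evaluated, as it cancels in ratios
of masses. -/
lemma integral_exp_hessForm {x : E d} (hx : (hessianMatrix U x).PosDef) :
    ∫ v, Real.exp (-(hessForm U x v / 2)) = gaussianMass d * laplaceWeight U x := by
  obtain ⟨B, hB, hQ, hw⟩ := exists_linearMap_hessForm hx
  simp only [hQ, hw]
  have hBc : Continuous B := B.continuous_of_finiteDimensional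
  have h1 : ∫ v, Real.exp (-(‖B v‖ ^ 2 / 2))
      = ∫ z, Real.exp (-(‖z‖ ^ 2 / 2)) ∂(Measure.map B (volume : Measure (E d))) :=
    (integral_map (f := fun z : E d => Real.exp (-(‖z‖ ^ 2 / 2))) hBc.aemeasurable
      (by fun_prop)).symm
  rw [h1, Measure.map_linearMap_addHaar_eq_smul_addHaar _ hB, integral_smul_measure,
    ENNReal.toReal_ofReal (abs_nonneg _), smul_eq_mul, mul_comm, gaussianMass]

/-! ### Taylor expansion at a minimizer -/

lemma norm_fderiv_sub_le_sq (hU : IsPotential U L a₀) :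
    ∃ M : ℝ, 0 ≤ M ∧ ∀ x v : E d,
      ‖fderiv ℝ U (x + v) - fderiv ℝ U x - fderiv ℝ (fderiv ℝ U) x v‖ ≤ M * ‖v‖ ^ 2 := by
  obtain ⟨M, hM⟩ := hU.hessian_lipschitz
  refine ⟨M, M.2, fun x v => ?_⟩
  have h := (convex_closedBall x ‖v‖).norm_image_sub_le_of_norm_fderiv_le' (𝕜 := ℝ)
    (f := fderiv ℝ U) (C := M * ‖v‖) (φ := fderiv ℝ (fderiv ℝ U) x)
    (fun z _ => hU.twice_differentiable z)
    (fun z hz => by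
      have h1 := hM.dist_le_mul z x
      rw [dist_eq_norm] at h1
      exact h1.trans (mul_le_mul_of_nonneg_left (Metric.mem_closedBall.1 hz) M.2))
    (Metric.mem_closedBall_self (norm_nonneg _)) (y := x + v) (by simp [dist_eq_norm])
  simp only [add_sub_cancel_left] at h
  linarith [h, sq ‖v‖, mul_assoc (M : ℝ) ‖v‖ ‖v‖]

lemma taylor_minimizer (hU : IsPotential U L a₀) :
    ∃ M : ℝ, 0 ≤ M ∧ ∀ x ∈ globalMinimizers U, ∀ v : E d,
      |U (x + v) - minValue U - hessForm U x v / 2| ≤ M * ‖v‖ ^ 3 := by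
  obtain ⟨M, hM0, hM⟩ := norm_fderiv_sub_le_sq hU
  refine ⟨M, hM0, fun x hx v => ?_⟩
  -- Subtracting the quadratic model along the segment leaves a function whose derivative is `O(‖v‖
  -- ^ 3)`, by the Lipschitz Hessian.
  set φ : ℝ → ℝ := fun t => U (x + t • v) - t ^ 2 * (hessForm U x v / 2)
  have hd : ∀ t, HasDerivAt φ (fderiv ℝ U (x + t • v) v - t * hessForm U x v) t := by
    intro t
    have h1 : HasDerivAt (fun t : ℝ => x + t • v) v t := by
      simpa using ((hasDerivAt_id t).smul_const v).const_add x
    have h2 := (hU.differentiable (x + t • v)).hasFDerivAt.comp_hasDerivAt t h1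
    have h3 := (hasDerivAt_pow 2 t).mul_const (hessForm U x v / 2)
    refine (h2.sub h3).congr_deriv ?_
    norm_num
    ring
  have hb : ∀ t ∈ Set.Ico (0 : ℝ) 1,
      ‖fderiv ℝ U (x + t • v) v - t * hessForm U x v‖ ≤ M * ‖v‖ ^ 3 := by
    intro t ht
    have h1 := hM x (t • v)
    rw [fderiv_eq_zero_of_mem hx, sub_zero, map_smul] at h1
    have h2 : fderiv ℝ U (x + t • v) v - t * hessForm U x v
        = (fderiv ℝ U (x + t • v) - t • fderiv ℝ (fderiv ℝ U) x v) v := by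
      simp [hessForm]
    rw [h2]
    refine (ContinuousLinearMap.le_opNorm _ _).trans ?_
    calc _ ≤ M * ‖t • v‖ ^ 2 * ‖v‖ := by gcongr
      _ ≤ M * ‖v‖ ^ 2 * ‖v‖ := by
          gcongr
          rw [norm_smul, Real.norm_of_nonneg ht.1]
          exact mul_le_of_le_one_left (norm_nonneg _) ht.2.le
      _ = _ := by ring
  have h := norm_image_sub_le_of_norm_deriv_le_segment_01' (f := φ)
    (fun t _ => (hd t).hasDerivWithinAt) hb
  rw [minValue_eq hx]
  simpa [φ, Real.norm_eq_abs, sub_right_comm] using h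

lemma exists_quadratic_lower_bound (hU : IsPotential U L a₀) (hreg : IsRegularAtMinimizers U)
    {x : E d} (hx : x ∈ globalMinimizers U) :
    ∃ c r₀ : ℝ, 0 < c ∧ 0 < r₀ ∧ (∀ v, c * ‖v‖ ^ 2 ≤ hessForm U x v / 2) ∧
      ∀ v, ‖v‖ ≤ r₀ → c * ‖v‖ ^ 2 ≤ U (x + v) - minValue U := by
  obtain ⟨c, hc, hcQ⟩ := exists_le_hessForm (hreg.hessian_posDef x hx)
  obtain ⟨M, hM0, hM⟩ := taylor_minimizer hU
  -- The cubic error may consume half of `c / 2 * ‖v‖ ^ 2`; `M + 1` avoids division by zero.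
  refine ⟨c / 4, c / (4 * (M + 1)), by positivity, by positivity, fun v => ?_, fun v hv => ?_⟩
  · nlinarith [hcQ v, sq_nonneg ‖v‖]
  · have h1 := (abs_le.1 (hM x hx v)).1
    have h2 := hcQ v
    have h3 : M * ‖v‖ ^ 3 ≤ c / 4 * ‖v‖ ^ 2 := by
      rw [le_div_iff₀ (by positivity)] at hv
      have : M * ‖v‖ ≤ c / 4 := by nlinarith [norm_nonneg v]
      calc M * ‖v‖ ^ 3 = M * ‖v‖ * ‖v‖ ^ 2 := by ring
        _ ≤ _ := by gcongr
    linarith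

/-- Compactness handles a bounded region, and the absence of minimizers at infinity handles the
rest. -/
lemma exists_pos_le_compl (hU : IsPotential U L a₀) {O : Set (E d)} (hO : IsOpen O)
    (hS : globalMinimizers U ⊆ O) : ∃ η : ℝ, 0 < η ∧ ∀ x ∉ O, η ≤ U x - minValue U := by
  obtain ⟨c, hc, hev⟩ := hU.no_minimizer_at_infinity
  obtain ⟨K, hK, hKc⟩ := Filter.mem_cocompact.1 hev
  have hcont := hU.differentiable.continuous
  obtain ⟨η, hη, hle⟩ : ∃ η : ℝ, 0 < η ∧ ∀ x ∈ K \ O, η ≤ U x - minValue U := by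
    rcases (K \ O).eq_empty_or_nonempty with he | hne
    · exact ⟨1, one_pos, by simp [he]⟩
    · obtain ⟨z, hz, hmin⟩ := (hK.diff hO).exists_isMinOn hne
        (f := fun x => U x - minValue U) (by fun_prop)
      refine ⟨U z - minValue U, ?_, fun x hx => hmin hx⟩
      refine lt_of_le_of_ne (sub_nonneg.2 (hU.minValue_le z)) fun h => hz.2 (hS fun y => ?_)
      linarith [hU.minValue_le y]
  refine ⟨min η (c - minValue U), lt_min hη (by linarith), fun x hx => ?_⟩
  by_cases hxK : x ∈ K
  · exact (min_le_left _ _).trans (hle x ⟨hxK, hx⟩)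
  · have : c ≤ U x := hKc hxK
    exact (min_le_right _ _).trans (by linarith)

/-! ### Laplace asymptotics -/

/-- Use `z ^ k ≤ k! * exp z`, then complete the square in `z - c z²`. -/
lemma exists_pow_mul_exp_le (k : ℕ) {c : ℝ} (hc : 0 < c) :
    ∃ K : ℝ, 0 ≤ K ∧ ∀ z : ℝ, 0 ≤ z → z ^ k * Real.exp (-(c * z ^ 2)) ≤ K := by
  refine ⟨k.factorial * Real.exp (1 / (4 * c)), by positivity, fun z hz => ?_⟩
  have h1 := Real.pow_div_factorial_le_exp z hz k
  rw [div_le_iff₀ (by positivity)] at h1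
  calc z ^ k * Real.exp (-(c * z ^ 2))
      ≤ Real.exp z * k.factorial * Real.exp (-(c * z ^ 2)) := by gcongr
    _ = k.factorial * Real.exp (z + -(c * z ^ 2)) := by rw [Real.exp_add]; ring
    _ ≤ _ := by
        gcongr
        have h2 : 0 ≤ (2 * c * z - 1) ^ 2 / (4 * c) := by positivity
        have h3 : (2 * c * z - 1) ^ 2 / (4 * c) = c * z ^ 2 - z + 1 / (4 * c) := by
          field_simp; ring
        linarith

lemma integrable_exp_neg_mul_norm_sq {c : ℝ} (hc : 0 < c) :
    Integrable (fun y : E d => Real.exp (-(c * ‖y‖ ^ 2))) := by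
  have h := GaussianFourier.integral_rexp_neg_mul_sq_norm (V := E d) hc
  simp only [← neg_mul]
  -- A non-integrable function has integral zero by convention, whereas this integral is positive.
  refine (not_imp_comm.1 integral_undef) ?_
  rw [h]
  positivity

lemma integrable_norm_pow_mul_exp (k : ℕ) {c : ℝ} (hc : 0 < c) :
    Integrable (fun y : E d => ‖y‖ ^ k * Real.exp (-(c * ‖y‖ ^ 2))) := by
  obtain ⟨K, -, hK⟩ := exists_pow_mul_exp_le k (half_pos hc)
  refine ((integrable_exp_neg_mul_norm_sq (half_pos hc)).const_mul K).mono' (by fun_prop)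
    (Filter.Eventually.of_forall fun y => ?_)
  rw [Real.norm_of_nonneg (by positivity)]
  calc ‖y‖ ^ k * Real.exp (-(c * ‖y‖ ^ 2))
      = ‖y‖ ^ k * Real.exp (-(c / 2 * ‖y‖ ^ 2)) * Real.exp (-(c / 2 * ‖y‖ ^ 2)) := by
        rw [mul_assoc, ← Real.exp_add]; congr 2; ring
    _ ≤ _ := by
        gcongr
        exact hK _ (norm_nonneg y)

lemma pow_mul_integral (f : E d → ℝ) (x : E d) {t : ℝ} (ht : 0 < t) :
    t ^ d * ∫ z, f z = ∫ y, f (x + t⁻¹ • y) := by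
  rw [Measure.integral_comp_inv_smul volume (fun y => f (x + y)) t,
    integral_add_left_eq_self (fun y => f y) x, abs_of_pos (by positivity)]
  simp

lemma abs_exp_neg_sub_exp_neg_le {A B m : ℝ} (hA : m ≤ A) (hB : m ≤ B) :
    |Real.exp (-A) - Real.exp (-B)| ≤ |A - B| * Real.exp (-m) := by
  wlog h : A ≤ B generalizing A B
  · rw [abs_sub_comm, abs_sub_comm A B]
    exact this hB hA (le_of_not_ge h)
  have h1 : Real.exp (-B) ≤ Real.exp (-A) := Real.exp_le_exp.2 (by linarith)
  have h2 : Real.exp (-B) = Real.exp (-A) * Real.exp (A - B) := by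
    rw [← Real.exp_add]; congr 1; ring
  have h3 := Real.add_one_le_exp (A - B)
  have h4 : Real.exp (-A) ≤ Real.exp (-m) := Real.exp_le_exp.2 (by linarith)
  rw [abs_of_nonneg (by linarith), abs_of_nonpos (by linarith)]
  calc Real.exp (-A) - Real.exp (-B) = Real.exp (-A) * (1 - Real.exp (A - B)) := by rw [h2]; ring
    _ ≤ Real.exp (-A) * (-(A - B)) := by gcongr; linarith
    _ ≤ Real.exp (-m) * (-(A - B)) := by gcongr; linarith
    _ = _ := by ring

/-- With `z = x + y / t` the integrand tends to the Gaussian of the Hessian, and the cubic Taylor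
error becomes `M ‖y‖ ^ 3 / t` against a Gaussian weight. -/
lemma laplace_ball (hU : IsPotential U L a₀) (hreg : IsRegularAtMinimizers U) {x : E d}
    (hx : x ∈ globalMinimizers U) {c r : ℝ} (hc : 0 < c) (hr : 0 < r)
    (hQ : ∀ v, c * ‖v‖ ^ 2 ≤ hessForm U x v / 2)
    (hV : ∀ v, ‖v‖ < r → c * ‖v‖ ^ 2 ≤ U (x + v) - minValue U) :
    ∃ K : ℝ, 0 ≤ K ∧ ∀ t : ℝ, 0 < t →
      |t ^ d * (∫ z in Metric.ball x r, Real.exp (-(t ^ 2 * (U z - minValue U))))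
        - gaussianMass d * laplaceWeight U x| ≤ K / t := by
  obtain ⟨M, hM0, hM⟩ := taylor_minimizer hU
  have hcont := hU.differentiable.continuous
  have hQc := continuous_hessForm (U := U) x
  set F : E d → ℝ := fun y => M * (‖y‖ ^ 3 * Real.exp (-(c * ‖y‖ ^ 2)))
    + r⁻¹ * (‖y‖ ^ 1 * Real.exp (-(c * ‖y‖ ^ 2)))
  have hF0 : ∀ y, 0 ≤ F y := fun y => by positivity
  have hF : Integrable F := ((integrable_norm_pow_mul_exp 3 hc).const_mul M).add
    ((integrable_norm_pow_mul_exp 1 hc).const_mul r⁻¹)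
  refine ⟨∫ y, F y, integral_nonneg hF0, fun t ht => ?_⟩
  set g : E d → ℝ := fun z => (Metric.ball x r).indicator
    (fun z => Real.exp (-(t ^ 2 * (U z - minValue U)))) z with hg
  have hgm : Measurable g := Measurable.indicator (by fun_prop) Metric.isOpen_ball.measurableSet
  set f₁ : E d → ℝ := fun y => g (x + t⁻¹ • y) with hf₁
  set f₂ : E d → ℝ := fun y => Real.exp (-(hessForm U x y / 2)) with hf₂
  have hmem : ∀ y : E d, x + t⁻¹ • y ∈ Metric.ball x r ↔ ‖t⁻¹ • y‖ < r := fun y => by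
    simp [Metric.mem_ball, dist_eq_norm]
  have hscale : ∀ y : E d, t ^ 2 * ‖t⁻¹ • y‖ ^ 2 = ‖y‖ ^ 2 := fun y => by
    rw [norm_smul, norm_inv, Real.norm_of_nonneg ht.le]; field_simp
  have hA : ∀ y : E d, ‖t⁻¹ • y‖ < r →
      c * ‖y‖ ^ 2 ≤ t ^ 2 * (U (x + t⁻¹ • y) - minValue U) := fun y hy => by
    rw [← hscale]
    have := mul_le_mul_of_nonneg_left (hV _ hy) (sq_nonneg t)
    linarith
  have hi1 : Integrable f₁ := by
    refine (integrable_exp_neg_mul_norm_sq hc).mono' ?_ (Filter.Eventually.of_forall fun y => ?_)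
    · exact (hgm.comp (by fun_prop)).aestronglyMeasurable
    · simp only [hf₁, hg]
      by_cases hy : ‖t⁻¹ • y‖ < r
      · rw [Set.indicator_of_mem ((hmem y).2 hy), Real.norm_of_nonneg (Real.exp_pos _).le,
          Real.exp_le_exp]
        linarith [hA y hy]
      · rw [Set.indicator_of_notMem (fun h => hy ((hmem y).1 h)), norm_zero]
        positivity
  have hi2 : Integrable f₂ := by
    refine (integrable_exp_neg_mul_norm_sq hc).mono' (by fun_prop)
      (Filter.Eventually.of_forall fun y => ?_)
    rw [Real.norm_of_nonneg (Real.exp_pos _).le, Real.exp_le_exp]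
    linarith [hQ y]
  have hpt : ∀ y, |f₁ y - f₂ y| ≤ F y / t := by
    intro y
    by_cases hy : ‖t⁻¹ • y‖ < r
    · have e1 : f₁ y = Real.exp (-(t ^ 2 * (U (x + t⁻¹ • y) - minValue U))) :=
        Set.indicator_of_mem ((hmem y).2 hy) _
      rw [e1]
      refine (abs_exp_neg_sub_exp_neg_le (hA y hy) (hQ y)).trans ?_
      have h1 := hM x hx (t⁻¹ • y)
      rw [hessForm_smul] at h1
      have h2 : t ^ 2 * (U (x + t⁻¹ • y) - minValue U) - hessForm U x y / 2
          = t ^ 2 * (U (x + t⁻¹ • y) - minValue U - t⁻¹ ^ 2 * hessForm U x y / 2) := by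
        field_simp
      rw [h2, abs_mul, abs_of_pos (by positivity : 0 < t ^ 2)]
      have h3 : t ^ 2 * (M * ‖t⁻¹ • y‖ ^ 3) = M * ‖y‖ ^ 3 / t := by
        rw [norm_smul, norm_inv, Real.norm_of_nonneg ht.le]; field_simp
      calc _ ≤ t ^ 2 * (M * ‖t⁻¹ • y‖ ^ 3) * Real.exp (-(c * ‖y‖ ^ 2)) := by gcongr
        _ = M * (‖y‖ ^ 3 * Real.exp (-(c * ‖y‖ ^ 2))) / t := by rw [h3]; ring
        _ ≤ F y / t := by
          gcongr
          exact le_add_of_nonneg_right (by positivity)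
    · have e1 : f₁ y = 0 := Set.indicator_of_notMem (fun h => hy ((hmem y).1 h)) _
      rw [e1, zero_sub, abs_neg, abs_of_pos (Real.exp_pos _)]
      -- Outside the rescaled ball `‖y‖ ≥ r t`, so a spare factor `‖y‖ / (r t)` pays for the
      -- Gaussian tail.
      have h1 : 1 ≤ r⁻¹ * ‖y‖ / t := by
        rw [norm_smul, norm_inv, Real.norm_of_nonneg ht.le, not_lt] at hy
        calc (1 : ℝ) = r⁻¹ * r := by field_simp
          _ ≤ r⁻¹ * (t⁻¹ * ‖y‖) := by gcongr
          _ = _ := by ring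
      calc f₂ y ≤ Real.exp (-(c * ‖y‖ ^ 2)) := Real.exp_le_exp.2 (by linarith [hQ y])
        _ ≤ r⁻¹ * ‖y‖ / t * Real.exp (-(c * ‖y‖ ^ 2)) :=
          le_mul_of_one_le_left (Real.exp_pos _).le h1
        _ = r⁻¹ * (‖y‖ ^ 1 * Real.exp (-(c * ‖y‖ ^ 2))) / t := by ring
        _ ≤ F y / t := by
          gcongr
          exact le_add_of_nonneg_left (by positivity)
  rw [← integral_indicator Metric.isOpen_ball.measurableSet, pow_mul_integral _ x ht,
    ← integral_exp_hessForm (hreg.hessian_posDef x hx), ← integral_sub hi1 hi2, ← integral_div]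
  exact (abs_integral_le_integral_abs).trans
    (integral_mono (hi1.sub hi2).abs (hF.div_const t) hpt)

lemma second_moment_ball {V : E d → ℝ} {x : E d} {c r : ℝ}
    (hc : 0 < c) (hV : ∀ v, ‖v‖ < r → c * ‖v‖ ^ 2 ≤ V (x + v)) :
    ∃ K : ℝ, 0 ≤ K ∧ ∀ t : ℝ, 0 < t →
      t ^ d * ∫ z in Metric.ball x r, ‖z - x‖ ^ 2 * Real.exp (-(t ^ 2 * V z)) ≤ K / t ^ 2 := by
  have hF := integrable_norm_pow_mul_exp (d := d) 2 hc
  refine ⟨∫ y : E d, ‖y‖ ^ 2 * Real.exp (-(c * ‖y‖ ^ 2)), integral_nonneg fun y => by positivity,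
    fun t ht => ?_⟩
  rw [← integral_indicator Metric.isOpen_ball.measurableSet, pow_mul_integral _ x ht,
    ← integral_div]
  refine integral_mono_of_nonneg (Filter.Eventually.of_forall fun y => ?_) (hF.div_const _)
    (Filter.Eventually.of_forall fun y => ?_)
  · exact Set.indicator_nonneg (fun z _ => by positivity) _
  · by_cases hy : ‖t⁻¹ • y‖ < r
    · simp only
      rw [Set.indicator_of_mem (by simpa [Metric.mem_ball, dist_eq_norm] using hy),
        add_sub_cancel_left]
      have hscale : ‖t⁻¹ • y‖ ^ 2 = ‖y‖ ^ 2 / t ^ 2 := by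
        rw [norm_smul, norm_inv, Real.norm_of_nonneg ht.le]; field_simp
      have h1 := mul_le_mul_of_nonneg_left (hV _ hy) (sq_nonneg t)
      rw [hscale] at h1 ⊢
      have h2 : t ^ 2 * (c * (‖y‖ ^ 2 / t ^ 2)) = c * ‖y‖ ^ 2 := by field_simp
      rw [h2] at h1
      calc _ ≤ ‖y‖ ^ 2 / t ^ 2 * Real.exp (-(c * ‖y‖ ^ 2)) := by gcongr
        _ = _ := by ring
    · simp only
      rw [Set.indicator_of_notMem (by simpa [Metric.mem_ball, dist_eq_norm] using hy)]
      positivity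

/-- Keep `exp (-a₀ V)` for integrability; the remaining factor is at most `exp (-(t² - a₀) η)`,
which beats `t ^ (d + 1)`. -/
lemma moment_outside {V : E d → ℝ} {O : Set (E d)} (hO : MeasurableSet O) {η : ℝ} (hη : 0 < η)
    (hV : ∀ x ∈ O, η ≤ V x) {f : E d → ℝ} (hf0 : ∀ x, 0 ≤ f x)
    (hf : Integrable fun x => f x * Real.exp (-(a₀ * V x))) :
    ∃ K : ℝ, 0 ≤ K ∧ ∀ t : ℝ, 0 < t → a₀ ≤ t ^ 2 →
      t ^ d * ∫ z in O, f z * Real.exp (-(t ^ 2 * V z)) ≤ K / t := by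
  obtain ⟨K, hK0, hK⟩ := exists_pow_mul_exp_le (d + 1) hη
  set J := ∫ z, f z * Real.exp (-(a₀ * V z))
  have hJ : 0 ≤ J := integral_nonneg fun x => mul_nonneg (hf0 x) (Real.exp_pos _).le
  refine ⟨K * Real.exp (a₀ * η) * J, by positivity, fun t ht hat => ?_⟩
  have h1 : ∫ z in O, f z * Real.exp (-(t ^ 2 * V z))
      ≤ Real.exp (-((t ^ 2 - a₀) * η)) * J := by
    calc _ ≤ ∫ z in O, Real.exp (-((t ^ 2 - a₀) * η)) * (f z * Real.exp (-(a₀ * V z))) := by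
          refine integral_mono_of_nonneg (Filter.Eventually.of_forall fun z =>
            mul_nonneg (hf0 z) (Real.exp_pos _).le) (hf.const_mul _).integrableOn ?_
          refine (ae_restrict_iff' hO).2 (Filter.Eventually.of_forall fun z hz => ?_)
          have h2 : Real.exp (-(t ^ 2 * V z))
              ≤ Real.exp (-((t ^ 2 - a₀) * η)) * Real.exp (-(a₀ * V z)) := by
            rw [← Real.exp_add, Real.exp_le_exp]
            nlinarith [mul_le_mul_of_nonneg_left (hV z hz) (sub_nonneg.2 hat)]
          calc _ ≤ f z * (Real.exp (-((t ^ 2 - a₀) * η)) * Real.exp (-(a₀ * V z))) :=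
                mul_le_mul_of_nonneg_left h2 (hf0 z)
            _ = _ := by ring
      _ = Real.exp (-((t ^ 2 - a₀) * η)) * ∫ z in O, f z * Real.exp (-(a₀ * V z)) :=
          integral_const_mul _ _
      _ ≤ _ := by
          gcongr
          exact setIntegral_le_integral hf (Filter.Eventually.of_forall fun z =>
            mul_nonneg (hf0 z) (Real.exp_pos _).le)
  rw [le_div_iff₀ ht]
  calc _ ≤ t ^ d * (Real.exp (-((t ^ 2 - a₀) * η)) * J) * t := by gcongr
    _ = t ^ (d + 1) * Real.exp (-(η * t ^ 2)) * Real.exp (a₀ * η) * J := by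
        rw [show -((t ^ 2 - a₀) * η) = -(η * t ^ 2) + a₀ * η by ring, Real.exp_add]; ring
    _ ≤ _ := by
        gcongr
        exact hK t ht.le

/-- Quadratic growth bounds the rescaled integrand below by a fixed Gaussian, uniformly down to `t²
= a₀`, where the Laplace asymptotics say nothing. The constant `L + 1` stays positive when `L = 0`.
-/
lemma exists_le_partition (hU : IsPotential U L a₀) :
    ∃ z : ℝ, 0 < z ∧ ∀ t : ℝ, 0 < t → a₀ ≤ t ^ 2 →
      z ≤ t ^ d * ∫ x, Real.exp (-(t ^ 2 * (U x - minValue U))) := by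
  obtain ⟨x, hx⟩ := hU.nonempty_minimizers
  have hL : (0 : ℝ) < L + 1 := by positivity
  refine ⟨∫ y : E d, Real.exp (-((L + 1) * ‖y‖ ^ 2)),
    MeasureTheory.integral_exp_pos (integrable_exp_neg_mul_norm_sq hL), fun t ht hat => ?_⟩
  have hint := integrable_exp_of_le hU hat
  have hint2 : Integrable fun y => Real.exp (-(t ^ 2 * (U (x + t⁻¹ • y) - minValue U))) :=
    (hint.comp_add_left x).comp_smul (inv_ne_zero ht.ne')
  rw [pow_mul_integral _ x ht]
  refine integral_mono (integrable_exp_neg_mul_norm_sq hL) hint2 fun y => ?_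
  simp only [Real.exp_le_exp, neg_le_neg_iff]
  have h1 := sub_minValue_le hU hx (x + t⁻¹ • y)
  rw [add_sub_cancel_left] at h1
  have hscale : t ^ 2 * ‖t⁻¹ • y‖ ^ 2 = ‖y‖ ^ 2 := by
    rw [norm_smul, norm_inv, Real.norm_of_nonneg ht.le]; field_simp
  have h2 := mul_le_mul_of_nonneg_left h1 (sq_nonneg t)
  nlinarith [sq_nonneg ‖y‖]

/-! ### Couplings with a product residual -/

lemma exists_coupling_add_residual {μ₁ μ₂ ν₁ ν₂ : Measure (E d)} [IsFiniteMeasure μ₂]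
    [IsFiniteMeasure ν₂] {ζ₁ : Measure (E d × E d)} (hζ₁ : ζ₁ ∈ couplings μ₁ ν₁)
    (hmass : μ₂ Set.univ = ν₂ Set.univ) :
    ∃ ζ ∈ couplings (μ₁ + μ₂) (ν₁ + ν₂),
      ∫⁻ z, ENNReal.ofReal (‖z.1 - z.2‖ ^ 2) ∂ζ ≤
        ∫⁻ z, ENNReal.ofReal (‖z.1 - z.2‖ ^ 2) ∂ζ₁
        + (∫⁻ x, ENNReal.ofReal (2 * ‖x‖ ^ 2) ∂μ₂ + ∫⁻ y, ENNReal.ofReal (2 * ‖y‖ ^ 2) ∂ν₂) := by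
  obtain ⟨h1, h2⟩ := hζ₁
  set R := μ₂ Set.univ with hR
  set ζ₂ : Measure (E d × E d) := R⁻¹ • μ₂.prod ν₂
  -- If `R = 0`, the factor `R⁻¹ = ∞` multiplies the zero measure.
  have key : ∀ (c : ℝ≥0∞) (m : Measure (E d)), c = R → m Set.univ = R → R ≠ ⊤ →
      R⁻¹ • (c • m) = m := by
    intro c m hc hm hRtop
    by_cases h0 : R = 0
    · rw [h0, Measure.measure_univ_eq_zero] at hm
      simp [hm]
    · rw [hc, smul_smul, ENNReal.inv_mul_cancel h0 hRtop, one_smul]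
  have hRtop : R ≠ ⊤ := measure_ne_top _ _
  have hm1 : ζ₂.map Prod.fst = μ₂ := by
    rw [Measure.map_smul, Measure.map_fst_prod]
    exact key _ _ hmass.symm rfl hRtop
  have hm2 : ζ₂.map Prod.snd = ν₂ := by
    rw [Measure.map_smul, Measure.map_snd_prod]
    exact key _ _ rfl hmass.symm hRtop
  refine ⟨ζ₁ + ζ₂, ⟨?_, ?_⟩, ?_⟩
  · rw [Measure.map_add _ _ measurable_fst, h1, hm1]
  · rw [Measure.map_add _ _ measurable_snd, h2, hm2]
  · rw [lintegral_add_measure]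
    gcongr
    conv_rhs => rw [← hm1, ← hm2]
    rw [lintegral_map (by fun_prop) measurable_fst, lintegral_map (by fun_prop)
      measurable_snd, ← lintegral_add_left (by fun_prop)]
    refine lintegral_mono fun z => ?_
    rw [← ENNReal.ofReal_add (by positivity) (by positivity)]
    refine ENNReal.ofReal_le_ofReal ?_
    have := norm_sub_le z.1 z.2
    nlinarith [norm_nonneg (z.1 - z.2), sq_nonneg (‖z.1‖ - ‖z.2‖)]

lemma W2_sq_le_of_coupling {μ ν : Measure (E d)} {ζ : Measure (E d × E d)}
    (hζ : ζ ∈ couplings μ ν) :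
    W2 μ ν ^ 2 ≤ ∫⁻ z, ENNReal.ofReal (‖z.1 - z.2‖ ^ 2) ∂ζ := by
  rw [W2, ← ENNReal.rpow_natCast, ← ENNReal.rpow_mul]
  simpa using iInf₂_le ζ hζ

/-- Transporting as much mass as possible from each `B i` to `x i`, and the rest by a product
measure. -/
lemma W2_sq_le_atomic {ι : Type*} [Fintype ι] (μ : Measure (E d)) [IsProbabilityMeasure μ]
    {B : ι → Set (E d)} (hBm : ∀ i, MeasurableSet (B i))
    (hBd : Pairwise (Function.onFun Disjoint B)) (x : ι → E d) (w : ι → ℝ≥0∞)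
    (hw : ∑ i, w i = 1) {D : ℝ} (hx : ∀ i, ‖x i‖ ≤ D) (hB : ∀ i, ∀ y ∈ B i, ‖y‖ ≤ D) :
    W2 μ (∑ i, w i • Measure.dirac (x i)) ^ 2 ≤
      ∑ i, ∫⁻ y in B i, ENNReal.ofReal (‖y - x i‖ ^ 2) ∂μ
      + ∫⁻ y in (⋃ i, B i)ᶜ, ENNReal.ofReal (2 * ‖y‖ ^ 2) ∂μ
      + ENNReal.ofReal (4 * D ^ 2) * ∑ i, (w i - μ (B i)) := by
  classical
  -- The fraction of the mass of `B i` that the atom `x i` can absorb; `0 / 0 = 0` covers null `B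
  -- i`.
  set α : ι → ℝ≥0∞ := fun i => min (μ (B i)) (w i) / μ (B i) with hα
  have hα1 : ∀ i, α i ≤ 1 := fun i => ENNReal.div_le_of_le_mul (by simp)
  have hαp : ∀ i, α i * μ (B i) = min (μ (B i)) (w i) := fun i => by
    by_cases h0 : μ (B i) = 0
    · simp [h0]
    · exact ENNReal.div_mul_cancel h0 (measure_ne_top _ _)
  have hwt : ∀ i, w i ≠ ⊤ := fun i => by
    refine ne_top_of_le_ne_top ENNReal.one_ne_top ?_
    rw [← hw]
    exact Finset.single_le_sum (fun _ _ => zero_le) (Finset.mem_univ i)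
  set μ₁ : Measure (E d) := ∑ i, α i • μ.restrict (B i) with hμ₁
  set μ₂ : Measure (E d) := μ.restrict (⋃ i, B i)ᶜ + ∑ i, (1 - α i) • μ.restrict (B i) with hμ₂
  set ν₁ : Measure (E d) := ∑ i, min (μ (B i)) (w i) • Measure.dirac (x i) with hν₁
  set ν₂ : Measure (E d) := ∑ i, (w i - μ (B i)) • Measure.dirac (x i) with hν₂
  set ζ₁ : Measure (E d × E d) := ∑ i, (α i • μ.restrict (B i)).prod (Measure.dirac (x i)) with hζ₁
  have hμ : μ = μ₁ + μ₂ := by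
    have h1 : μ.restrict (⋃ i, B i) = ∑ i, μ.restrict (B i) := by
      rw [Measure.restrict_iUnion hBd hBm, Measure.sum_fintype]
    conv_lhs => rw [← Measure.restrict_add_restrict_compl (μ := μ)
      (MeasurableSet.iUnion hBm), h1]
    rw [hμ₁, hμ₂, add_left_comm, ← Finset.sum_add_distrib, add_comm]
    congr 1
    refine Finset.sum_congr rfl fun i _ => ?_
    rw [← add_smul, add_tsub_cancel_of_le (hα1 i), one_smul]
  have hν : ∑ i, w i • Measure.dirac (x i) = ν₁ + ν₂ := by
    rw [hν₁, hν₂, ← Finset.sum_add_distrib]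
    refine Finset.sum_congr rfl fun i _ => ?_
    rw [← add_smul]
    congr 1
    rcases le_total (μ (B i)) (w i) with h | h
    · rw [min_eq_left h, add_tsub_cancel_of_le h]
    · rw [min_eq_right h, tsub_eq_zero_of_le h, add_zero]
  have hμ₁u : μ₁ Set.univ = ∑ i, min (μ (B i)) (w i) := by
    rw [hμ₁, Measure.finsetSum_apply]
    simp [hαp]
  have hν₁u : ν₁ Set.univ = ∑ i, min (μ (B i)) (w i) := by
    rw [hν₁, Measure.finsetSum_apply]
    simp
  have hν₂u : ν₂ Set.univ = ∑ i, (w i - μ (B i)) := by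
    rw [hν₂, Measure.finsetSum_apply]
    simp
  have hμu : μ₁ Set.univ + μ₂ Set.univ = 1 := by
    rw [← Measure.add_apply, ← hμ, measure_univ]
  have hνu : ν₁ Set.univ + ν₂ Set.univ = 1 := by
    rw [← Measure.add_apply, ← hν, Measure.finsetSum_apply]
    simpa using hw
  have hμ₁t : μ₁ Set.univ ≠ ⊤ :=
    ne_top_of_le_ne_top ENNReal.one_ne_top (hμu ▸ le_self_add)
  have hmass : μ₂ Set.univ = ν₂ Set.univ := by
    rw [← hνu, hν₁u, ← hμ₁u] at hμu
    exact (ENNReal.add_right_inj hμ₁t).1 hμu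
  have hf1 : IsFiniteMeasure μ₂ :=
    ⟨lt_of_le_of_lt (hμu ▸ le_add_self) ENNReal.one_lt_top⟩
  have hf2 : IsFiniteMeasure ν₂ := ⟨hmass ▸ hf1.measure_univ_lt_top⟩
  have hfi : ∀ i, IsFiniteMeasure (α i • μ.restrict (B i)) := fun i =>
    Measure.smul_finite _ (ne_top_of_le_ne_top ENNReal.one_ne_top (hα1 i))
  have hcoup : ζ₁ ∈ couplings μ₁ ν₁ := by
    constructor
    · rw [hζ₁, hμ₁, Measure.map_finset_sum measurable_fst.aemeasurable]
      simp
    · rw [hζ₁, hν₁, Measure.map_finset_sum measurable_snd.aemeasurable]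
      simp [hαp]
  obtain ⟨ζ, hζ, hcost⟩ := exists_coupling_add_residual hcoup hmass
  rw [← hμ, ← hν] at hζ
  refine (W2_sq_le_of_coupling hζ).trans (hcost.trans ?_)
  have hD : ∀ y : E d, ‖y‖ ≤ D → ENNReal.ofReal (2 * ‖y‖ ^ 2) ≤ ENNReal.ofReal (2 * D ^ 2) :=
    fun y hy => ENNReal.ofReal_le_ofReal (by gcongr)
  have c1 : ∫⁻ z, ENNReal.ofReal (‖z.1 - z.2‖ ^ 2) ∂ζ₁
      ≤ ∑ i, ∫⁻ y in B i, ENNReal.ofReal (‖y - x i‖ ^ 2) ∂μ := by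
    rw [hζ₁, lintegral_finsetSum_measure]
    refine Finset.sum_le_sum fun i _ => ?_
    rw [lintegral_prod _ (by fun_prop), lintegral_smul_measure]
    rw [smul_eq_mul]
    refine (mul_le_of_le_one_left (zero_le) (hα1 i)).trans (le_of_eq ?_)
    refine lintegral_congr fun y => ?_
    rw [lintegral_dirac' _ (by fun_prop)]
  have c2 : ∫⁻ y, ENNReal.ofReal (2 * ‖y‖ ^ 2) ∂ν₂
      ≤ ENNReal.ofReal (2 * D ^ 2) * ∑ i, (w i - μ (B i)) := by
    rw [hν₂, lintegral_finsetSum_measure, Finset.mul_sum]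
    refine Finset.sum_le_sum fun i _ => ?_
    rw [lintegral_smul_measure, lintegral_dirac' _ (by fun_prop), smul_eq_mul, mul_comm]
    exact mul_le_mul_left (hD _ (hx i)) _
  -- The excess left in the balls is at most the total mass of `μ₂`, which equals the total deficit
  -- `∑ i, (w i - μ (B i))` of the atoms.
  have c3 : ∫⁻ y, ENNReal.ofReal (2 * ‖y‖ ^ 2) ∂μ₂
      ≤ ∫⁻ y in (⋃ i, B i)ᶜ, ENNReal.ofReal (2 * ‖y‖ ^ 2) ∂μ
        + ENNReal.ofReal (2 * D ^ 2) * ∑ i, (w i - μ (B i)) := by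
    rw [hμ₂, lintegral_add_measure]
    gcongr
    rw [lintegral_finsetSum_measure, ← hν₂u, ← hmass]
    calc _ ≤ ∑ i, (1 - α i) * (ENNReal.ofReal (2 * D ^ 2) * μ (B i)) := by
          refine Finset.sum_le_sum fun i _ => ?_
          rw [lintegral_smul_measure, smul_eq_mul, ← setLIntegral_const]
          refine mul_le_mul_right ?_ _
          exact setLIntegral_mono' (hBm i) fun y hy => hD y (hB i y hy)
      _ = ENNReal.ofReal (2 * D ^ 2) * (∑ i, (1 - α i) • μ.restrict (B i)) Set.univ := by
          rw [Measure.finsetSum_apply, Finset.mul_sum]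
          refine Finset.sum_congr rfl fun i _ => ?_
          simp only [Measure.smul_apply, Measure.restrict_apply_univ, smul_eq_mul]
          ring
      _ ≤ _ := by
          rw [hμ₂]
          exact mul_le_mul_right (Measure.le_add_left le_rfl _) _
  have c4 : ENNReal.ofReal (4 * D ^ 2) =
      ENNReal.ofReal (2 * D ^ 2) + ENNReal.ofReal (2 * D ^ 2) := by
    rw [← ENNReal.ofReal_add (by positivity) (by positivity)]
    congr 1; ring
  rw [c4, add_mul]
  refine (add_le_add c1 (add_le_add c3 c2)).trans (le_of_eq ?_)
  ring

/-! ### The rate of convergence to the limit measure -/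

lemma setLIntegral_gibbs (hU : IsPotential U L a₀) {t : ℝ} (ht : 0 < t) (hat : a₀ ≤ t ^ 2)
    {A : Set (E d)} (hA : MeasurableSet A) {f : E d → ℝ} (hf : Measurable f) (hf0 : ∀ x, 0 ≤ f x)
    (hint : Integrable fun x => f x * Real.exp (-(t ^ 2 * (U x - minValue U)))) :
    ∫⁻ x in A, ENNReal.ofReal (f x) ∂(gibbs U (t ^ 2)) =
      ENNReal.ofReal ((t ^ d * ∫ x in A, f x * Real.exp (-(t ^ 2 * (U x - minValue U)))) /
        (t ^ d * ∫ x, Real.exp (-(t ^ 2 * (U x - minValue U))))) := by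
  have hqm : Measurable (gibbsDensity U (t ^ 2)) := (contDiff_gibbsDensity hU).continuous.measurable
  rw [gibbs, densityMeasure, setLIntegral_withDensity_eq_setLIntegral_mul _ (by fun_prop)
    (by fun_prop) hA, mul_div_mul_left _ _ (pow_pos ht d).ne', ← integral_div,
    ofReal_integral_eq_lintegral_ofReal (hint.div_const _).integrableOn]
  · refine lintegral_congr fun x => ?_
    rw [Pi.mul_apply, ← ENNReal.ofReal_mul (gibbsDensity_pos hU hat x).le, gibbsDensity_eq]
    congr 1
    ring
  · exact Filter.Eventually.of_forall fun x =>
      div_nonneg (mul_nonneg (hf0 x) (Real.exp_pos _).le) (integral_exp_pos hU hat).le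

lemma integrable_norm_sub_sq_mul_exp (hU : IsPotential U L a₀) (hLSI : GibbsLogSobolev U a₀)
    (ha : a₀ ≤ a) (x : E d) :
    Integrable fun y => ‖y - x‖ ^ 2 * Real.exp (-(a * (U y - minValue U))) := by
  have hcont := hU.differentiable.continuous
  have hZ := integral_exp_pos hU ha
  have h1 : Integrable fun y => ‖y‖ ^ 2 * Real.exp (-(a * (U y - minValue U))) := by
    refine ((integrable_norm_sq_mul_gibbsDensity hU hLSI ha).const_mul
      (∫ y, Real.exp (-(a * (U y - minValue U))))).congr (Filter.Eventually.of_forall fun y => ?_)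
    simp only [gibbsDensity_eq]
    field_simp
  refine ((h1.const_mul 2).add ((integrable_exp_of_le hU ha).const_mul (2 * ‖x‖ ^ 2))).mono'
    (by fun_prop) (Filter.Eventually.of_forall fun y => ?_)
  rw [Real.norm_of_nonneg (by positivity), Pi.add_apply, ← mul_assoc, ← add_mul]
  gcongr
  have := norm_sub_le y x
  nlinarith [norm_nonneg (y - x), sq_nonneg (‖y‖ - ‖x‖)]

lemma limitMeasure_eq_sum [Fintype (globalMinimizers U)] :
    limitMeasure U = ∑ i : globalMinimizers U,
      ENNReal.ofReal (laplaceWeight U i / ∑ j : globalMinimizers U, laplaceWeight U j) •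
        Measure.dirac (i : E d) := by
  rw [limitMeasure, Measure.sum_fintype, ← finsum_set_coe_eq_finsum_mem,
    finsum_eq_sum_of_fintype]

/-- Disjoint balls around the minimizers on which `U` grows quadratically. -/
lemma exists_balls (hU : IsPotential U L a₀) (hreg : IsRegularAtMinimizers U) :
    ∃ c r : globalMinimizers U → ℝ, (∀ i, 0 < c i) ∧ (∀ i, 0 < r i) ∧
      (∀ i v, c i * ‖v‖ ^ 2 ≤ hessForm U i v / 2) ∧
      (∀ i v, ‖v‖ < r i → c i * ‖v‖ ^ 2 ≤ U (i + v) - minValue U) ∧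
      Pairwise (Function.onFun Disjoint fun i : globalMinimizers U =>
        Metric.ball (i : E d) (r i)) := by
  choose c r₀ hc hr₀ hQ hV using fun i : globalMinimizers U =>
    exists_quadratic_lower_bound hU hreg i.2
  obtain ⟨O, hO, hdisj⟩ := hU.finite_minimizers.t2_separation
  choose r₁ hr₁ hball using fun i : globalMinimizers U =>
    Metric.isOpen_iff.1 (hO i).2 i (hO i).1
  refine ⟨c, fun i => min (r₀ i) (r₁ i), hc, fun i => lt_min (hr₀ i) (hr₁ i), hQ,
    fun i v hv => hV i v (hv.le.trans (min_le_left _ _)), fun i j hij => ?_⟩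
  have h := hdisj i.2 j.2 (fun h => hij (Subtype.ext h))
  exact h.mono ((Metric.ball_subset_ball (min_le_right _ _)).trans (hball i))
    ((Metric.ball_subset_ball (min_le_right _ _)).trans (hball j))

lemma wassersteinRate_of_sq_le {K : ℝ} (hK : 0 < K)
    (h : ∀ t : ℝ, 0 < t → a₀ ≤ t ^ 2 →
      W2 (gibbs U (t ^ 2)) (limitMeasure U) ^ 2 ≤ ENNReal.ofReal (K / t)) (ha₀ : 0 < a₀) :
    WassersteinRate U a₀ (√K) := by
  intro a ha
  have hapos : 0 < a := ha₀.trans_le ha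
  have h1 := h (√a) (Real.sqrt_pos.2 hapos) (by rwa [Real.sq_sqrt hapos.le])
  rw [Real.sq_sqrt hapos.le] at h1
  refine (ENNReal.pow_le_pow_left_iff two_ne_zero).1 (h1.trans (le_of_eq ?_))
  rw [← ENNReal.ofReal_pow (by positivity), mul_pow, Real.sq_sqrt hK.le]
  congr 1
  rw [Real.sqrt_eq_rpow, div_eq_mul_inv, ← Real.rpow_neg hapos.le, ← Real.rpow_natCast,
    ← Real.rpow_mul hapos.le]
  norm_num

/-- The ratio of two quantities that are close to `g * l` and `g * Λ`. -/
lemma sub_div_le {g l Λ J T κ κ' z : ℝ} (hz : 0 < z) (hT : z ≤ T) (hl : 0 ≤ l) (hlΛ : l ≤ Λ)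
    (hΛ : 0 < Λ) (hJ : |J - g * l| ≤ κ) (hTΛ : |T - g * Λ| ≤ κ') :
    l / Λ - J / T ≤ (κ + κ') / z := by
  have hTpos := hz.trans_le hT
  have hw1 : l / Λ ≤ 1 := (div_le_one hΛ).2 hlΛ
  have hw0 : 0 ≤ l / Λ := div_nonneg hl hΛ.le
  -- The contributions of `g` cancel, since `l / Λ * (g * Λ) = g * l`.
  have h1 : l / Λ - J / T = (l / Λ * (T - g * Λ) - (J - g * l)) / T := by
    field_simp
    ring
  have h2 : l / Λ * (T - g * Λ) ≤ κ' := by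
    calc _ ≤ l / Λ * |T - g * Λ| := mul_le_mul_of_nonneg_left (le_abs_self _) hw0
      _ ≤ 1 * |T - g * Λ| := mul_le_mul_of_nonneg_right hw1 (abs_nonneg _)
      _ ≤ κ' := by rwa [one_mul]
  have h3 := (abs_le.1 hJ).1
  have hκ : 0 ≤ κ + κ' := add_nonneg ((abs_nonneg _).trans hJ) ((abs_nonneg _).trans hTΛ)
  rw [h1]
  calc _ ≤ (κ + κ') / T := by gcongr; linarith
    _ ≤ _ := by gcongr

theorem exists_wassersteinRate (hU : IsPotential U L a₀) (hLSI : GibbsLogSobolev U a₀)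
    (hreg : IsRegularAtMinimizers U) : ∃ C : ℝ, 0 < C ∧ WassersteinRate U a₀ C := by
  have : Fintype (globalMinimizers U) := hU.finite_minimizers.fintype
  have hne : Nonempty (globalMinimizers U) := hU.nonempty_minimizers.to_subtype
  obtain ⟨c, r, hc, hr, hQ, hV, hdisj⟩ := exists_balls hU hreg
  set B : globalMinimizers U → Set (E d) := fun i => Metric.ball (i : E d) (r i)
  have hBo : ∀ i, IsOpen (B i) := fun i => Metric.isOpen_ball
  have hBm : ∀ i, MeasurableSet (B i) := fun i => (hBo i).measurableSet
  have hUm : MeasurableSet (⋃ i, B i) := MeasurableSet.iUnion hBm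
  obtain ⟨η, hη, hηV⟩ := exists_pos_le_compl hU (isOpen_iUnion hBo)
    (fun x hx => Set.mem_iUnion.2 ⟨⟨x, hx⟩, Metric.mem_ball_self (hr _)⟩)
  choose K₁ hK₁0 hK₁ using fun i : globalMinimizers U =>
    laplace_ball hU hreg i.2 (hc i) (hr i) (hQ i) (hV i)
  choose K₂ hK₂0 hK₂ using fun i : globalMinimizers U =>
    second_moment_ball (V := fun z => U z - minValue U) (hc i) (hV i)
  obtain ⟨K₃, hK₃0, hK₃⟩ := moment_outside hUm.compl hη hηV (f := fun _ => 1)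
    (fun _ => zero_le_one) (by simpa using integrable_exp_of_le hU le_rfl)
  have hmom : ∀ a, a₀ ≤ a →
      Integrable fun y => 2 * ‖y‖ ^ 2 * Real.exp (-(a * (U y - minValue U))) := fun a ha => by
    simpa [mul_assoc] using (integrable_norm_sub_sq_mul_exp hU hLSI ha 0).const_mul 2
  obtain ⟨K₄, hK₄0, hK₄⟩ := moment_outside hUm.compl hη hηV (f := fun y => 2 * ‖y‖ ^ 2)
    (fun y => by positivity) (hmom a₀ le_rfl)
  obtain ⟨z, hz, hzT⟩ := exists_le_partition hU
  set l : globalMinimizers U → ℝ := fun i => laplaceWeight U i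
  have hl : ∀ i, 0 < l i := fun i => laplaceWeight_pos (hreg.hessian_posDef i i.2)
  set Λ : ℝ := ∑ i, l i
  have hΛ : 0 < Λ := Finset.sum_pos (fun i _ => hl i) Finset.univ_nonempty
  set D : ℝ := ∑ i : globalMinimizers U, (‖(i : E d)‖ + r i)
  have hD : ∀ i : globalMinimizers U, ‖(i : E d)‖ + r i ≤ D := fun i =>
    Finset.single_le_sum (f := fun i : globalMinimizers U => ‖(i : E d)‖ + r i)
      (fun j _ => add_nonneg (norm_nonneg _) (hr j).le) (Finset.mem_univ i)
  set κ : ℝ := ∑ i, K₁ i + K₃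
  have hs₀ : 0 < √a₀ := Real.sqrt_pos.2 hU.a₀_pos
  -- The terms are transport inside the balls, mass outside them, and the weight deficits. The
  -- factor `√a₀` trades one `1 / t` of the `1 / t²` bound for a constant.
  set K : ℝ := ∑ i, K₂ i / (√a₀ * z) + K₄ / z + 4 * D ^ 2 * ∑ i, (K₁ i + κ) / z with hK
  have hK0 : 0 ≤ K := by
    have hκ : 0 ≤ κ := add_nonneg (Finset.sum_nonneg fun i _ => hK₁0 i) hK₃0
    refine add_nonneg (add_nonneg (Finset.sum_nonneg fun i _ => ?_) (by positivity))
      (mul_nonneg (by positivity) (Finset.sum_nonneg fun i _ => ?_))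
    · exact div_nonneg (hK₂0 i) (by positivity)
    · exact div_nonneg (add_nonneg (hK₁0 i) hκ) hz.le
  -- `K` is only known to be nonnegative, and the constant must be positive.
  refine ⟨√(K + 1), Real.sqrt_pos.2 (by linarith), wassersteinRate_of_sq_le (by linarith)
    (fun t ht hat => ?_) hU.a₀_pos⟩
  have := isProbabilityMeasure_gibbs hU hat
  set Z := t ^ d * ∫ x, Real.exp (-(t ^ 2 * (U x - minValue U)))
  have hzZ : z ≤ Z := hzT t ht hat
  have hZ : 0 < Z := hz.trans_le hzZ
  set J : globalMinimizers U → ℝ :=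
    fun i => t ^ d * ∫ x in B i, Real.exp (-(t ^ 2 * (U x - minValue U)))
  have hJ : ∀ i, |J i - gaussianMass d * l i| ≤ K₁ i / t := fun i => hK₁ i t ht
  have hint := integrable_exp_of_le hU hat
  have hZsum : |Z - gaussianMass d * Λ| ≤ κ / t := by
    have h1 : Z = ∑ i, J i
        + t ^ d * ∫ x in (⋃ i, B i)ᶜ, Real.exp (-(t ^ 2 * (U x - minValue U))) := by
      simp only [Z, J]
      rw [← integral_add_compl hUm hint,
        integral_iUnion_fintype hBm hdisj (fun i => hint.integrableOn), mul_add, Finset.mul_sum]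
    have h2 := hK₃ t ht hat
    simp only [one_mul] at h2
    have h3 : 0 ≤ t ^ d * ∫ x in (⋃ i, B i)ᶜ, Real.exp (-(t ^ 2 * (U x - minValue U))) :=
      mul_nonneg (by positivity) (integral_nonneg fun x => (Real.exp_pos _).le)
    have h4 : Z - gaussianMass d * Λ = ∑ i, (J i - gaussianMass d * l i)
        + t ^ d * ∫ x in (⋃ i, B i)ᶜ, Real.exp (-(t ^ 2 * (U x - minValue U))) := by
      rw [h1, Finset.sum_sub_distrib, ← Finset.mul_sum Finset.univ l (gaussianMass d)]; ring
    rw [h4, add_div, Finset.sum_div]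
    refine (abs_add_le _ _).trans (add_le_add ?_ ?_)
    · exact (Finset.abs_sum_le_sum_abs _ _).trans (Finset.sum_le_sum fun i _ => hJ i)
    · rwa [abs_of_nonneg h3]
  have hcost : ∀ i : globalMinimizers U,
      ∫⁻ y in B i, ENNReal.ofReal (‖y - i‖ ^ 2) ∂(gibbs U (t ^ 2))
        ≤ ENNReal.ofReal (K₂ i / (√a₀ * z) / t) := fun i => by
    rw [setLIntegral_gibbs hU ht hat (hBm i) (by fun_prop) (fun y => by positivity)
      (integrable_norm_sub_sq_mul_exp hU hLSI hat i)]
    refine ENNReal.ofReal_le_ofReal ?_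
    have hst : √a₀ ≤ t := Real.sqrt_le_iff.2 ⟨ht.le, hat⟩
    have h1 : K₂ i / t ^ 2 / z ≤ K₂ i / (√a₀ * z) / t := by
      rw [div_div, div_div]
      refine div_le_div_of_nonneg_left (hK₂0 i) (by positivity) ?_
      nlinarith [mul_le_mul_of_nonneg_right hst (mul_pos hz ht).le]
    refine le_trans ?_ h1
    refine div_le_div₀ (div_nonneg (hK₂0 i) (by positivity)) (hK₂ i t ht) hz hzZ
  have hrest : ∫⁻ y in (⋃ i, B i)ᶜ, ENNReal.ofReal (2 * ‖y‖ ^ 2) ∂(gibbs U (t ^ 2))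
      ≤ ENNReal.ofReal (K₄ / z / t) := by
    rw [setLIntegral_gibbs hU ht hat hUm.compl (by fun_prop) (fun y => by positivity)
      (hmom _ hat), div_right_comm]
    exact ENNReal.ofReal_le_ofReal
      (div_le_div₀ (div_nonneg hK₄0 ht.le) (hK₄ t ht hat) hz hzZ)
  have hmass : ∀ i, gibbs U (t ^ 2) (B i) = ENNReal.ofReal (J i / Z) := fun i => by
    have h := setLIntegral_gibbs hU ht hat (hBm i) (f := fun _ => 1) measurable_const
      (fun _ => zero_le_one) (by simpa using hint)
    simpa [J, Z] using h
  -- Subtraction is truncated: only deficits of ball mass count, so a one-sided estimate is enough.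
  have hdef : ∀ i, ENNReal.ofReal (l i / Λ) - gibbs U (t ^ 2) (B i)
      ≤ ENNReal.ofReal ((K₁ i + κ) / z / t) := fun i => by
    have hJ0 : 0 ≤ J i := mul_nonneg (by positivity) (integral_nonneg fun x => (Real.exp_pos _).le)
    rw [hmass, ← ENNReal.ofReal_sub _ (div_nonneg hJ0 hZ.le)]
    refine ENNReal.ofReal_le_ofReal ((sub_div_le hz hzZ (hl i).le
      (Finset.single_le_sum (fun j _ => (hl j).le) (Finset.mem_univ i)) hΛ (hJ i) hZsum).trans
      (le_of_eq ?_))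
    ring
  have hw : ∑ i, ENNReal.ofReal (l i / Λ) = 1 := by
    rw [← ENNReal.ofReal_sum_of_nonneg (fun i _ => div_nonneg (hl i).le hΛ.le), ← Finset.sum_div,
      div_self hΛ.ne', ENNReal.ofReal_one]
  rw [limitMeasure_eq_sum]
  refine (W2_sq_le_atomic (gibbs U (t ^ 2)) hBm hdisj (fun i => (i : E d)) _ hw (D := D)
    (fun i => by linarith [hD i, hr i]) (fun i y hy => ?_)).trans ?_
  · have h1 := mem_ball_iff_norm.1 hy
    have h2 := norm_le_norm_add_norm_sub' y (i : E d)
    linarith [hD i]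
  · calc _ ≤ ∑ i, ENNReal.ofReal (K₂ i / (√a₀ * z) / t) + ENNReal.ofReal (K₄ / z / t)
          + ENNReal.ofReal (4 * D ^ 2) * ∑ i, ENNReal.ofReal ((K₁ i + κ) / z / t) :=
          add_le_add (add_le_add (Finset.sum_le_sum fun i _ => hcost i) hrest)
            (mul_le_mul_right (Finset.sum_le_sum fun i _ => hdef i) _)
      _ = ENNReal.ofReal (K / t) := by
          have hκ : 0 ≤ κ := add_nonneg (Finset.sum_nonneg fun i _ => hK₁0 i) hK₃0
          have e1 : ∀ i, 0 ≤ K₂ i / (√a₀ * z) / t := fun i => by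
            have := hK₂0 i
            positivity
          have e2 : ∀ i, 0 ≤ (K₁ i + κ) / z / t := fun i => by
            have := hK₁0 i
            positivity
          rw [← ENNReal.ofReal_sum_of_nonneg fun i _ => e1 i,
            ← ENNReal.ofReal_sum_of_nonneg fun i _ => e2 i, ← ENNReal.ofReal_mul (by positivity),
            ← ENNReal.ofReal_add (Finset.sum_nonneg fun i _ => e1 i) (by positivity),
            ← ENNReal.ofReal_add (add_nonneg (Finset.sum_nonneg fun i _ => e1 i) (by positivity))
              (mul_nonneg (by positivity) (Finset.sum_nonneg fun i _ => e2 i)),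
            hK]
          congr 1
          simp only [← Finset.sum_div]
          ring
      _ ≤ _ := by
          refine ENNReal.ofReal_le_ofReal ?_
          gcongr
          linarith

end GibbsOpt

theorem theoremS5 {d : ℕ} (U : GibbsOpt.E d → ℝ) (L : ℝ≥0) (a₀ : ℝ)
    (hU : GibbsOpt.IsPotential U L a₀)
    (hLSI : GibbsOpt.GibbsLogSobolev U a₀)
    (hreg : GibbsOpt.IsRegularAtMinimizers U) :
    (∃ C : ℝ, 0 < C ∧ GibbsOpt.WassersteinRate U a₀ C) ∧
    ∀ C : ℝ, 0 < C → GibbsOpt.WassersteinRate U a₀ C →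
      ∀ ε δ a : ℝ, 0 < ε → ε < 1 / 2 → 0 < δ → δ < 1 →
      max a₀ (9 * C ^ 4 * (L : ℝ) ^ 2 / ε ^ 2) ≤ a →
      ∀ N : ℕ, 18 * Real.log (1 / δ) / ε ^ 2 ≤ (N : ℝ) →
      ∀ μt : Measure (GibbsOpt.E d), IsProbabilityMeasure μt →
      klDiv μt (GibbsOpt.gibbs U a) ≤ ENNReal.ofReal (ε ^ 2 / 18) →
      ∀ {Ω : Type*} [MeasurableSpace Ω] (P : Measure Ω) [IsProbabilityMeasure P]
        (Xout : Ω → GibbsOpt.E d), GibbsOpt.IsAlgorithmOutput P U μt N Xout →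
        P {ω | ε ≤ U (Xout ω) - GibbsOpt.minValue U} ≤ ENNReal.ofReal δ := by
  exact ⟨GibbsOpt.exists_wassersteinRate hU hLSI hreg,
    fun C hC hW ε δ a hε hε' hδ hδ' ha N hN μt _ hKL _ _ P _ Xout hX =>
      GibbsOpt.algorithm_guarantee hU hC hW hε hε' hδ hδ' ha hN μt hKL P Xout hX⟩
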